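/- Let $M$ be a $C^\infty$ manifold of dimension $2m+1$ with a cosymplectic structure $(\phi,\xi,\eta,g_M)$, i.e. a smooth $(1,1)$-tensor field $\phi$, vector field $\xi$, one-form $\eta$ and Riemannian metric $g_M$ with $\phi^2=-I+\eta\otimes\xi$, $\phi\xi=0$, $\eta\circ\phi=0$, $\eta(\xi)=1$, $g_M(\phi X,\phi Y)=g_M(X,Y)-\eta(X)\eta(Y)$, $\eta(X)=g_M(X,\xi)$, which is normal ($[\phi,\phi]+2\,d\eta\otimes\xi=0$, where $[\phi,\phi]$ is the Nijenhuis tensor of $\phi$ and $2\,d\eta(X,Y)=X\eta(Y)-Y\eta(X)-\eta([X,Y])$) and for which $\eta$ and the two-form $\Phi(X,Y)=g_M(X,\phi Y)$ are closed. Let $(N,g_N)$ be a Riemannian manifold and let $F:M\to N$ be a Riemannian submersion (smooth, onto, of maximal rank, with $F_*$ preserving the lengths of vectors orthogonal to $\ker F_*$). Suppose that $F$ is anti-invariant, i.e. $\phi(\ker F_*)\subseteq(\ker F_*)^\perp$, and that $$(\ker F_*)^\perp=\phi(\ker F_*)\oplus\langle\xi\rangle .$$ Let $\nabla$ be the Levi-Civita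 connection of $g_M$, let $\mathcal V$ and $\mathcal H$ be the orthogonal projections of $TM$ onto $\ker F_*$ and $(\ker F_*)^\perp$, and let $$\mathcal T_XY=\mathcal H\nabla_{\mathcal VX}\mathcal VY+\mathcal V\nabla_{\mathcal VX}\mathcal HY,\qquad \mathcal A_XY=\mathcal V\nabla_{\mathcal HX}\mathcal HY+\mathcal H\nabla_{\mathcal HX}\mathcal VY$$ be O'Neill's tensors of $F$. Call $M$ a locally product manifold (with respect to $\ker F_*$ and $(\ker F_*)^\perp$) if every point of $M$ has an open neighbourhood that is isometric to a product $(U_1,g_1)\times(U_2,g_2)$ of Riemannian manifolds in such a way that $\ker F_*$ is the distribution tangent to the first factor and $(\ker F_*)^\perp$ the distribution tangent to the second factor. Then $M$ is a locally product manifold if and only if $$\mathcal A_X\phi Y=0\quad\text{and}\quad \mathcal T_V\phi W=0$$ for all smooth horizontal vector fields $X,Y\in\Gamma((\ker F_*)^\perp)$ and all smooth vertical vector fields $V,W\in\Gamma(\ker F_*)$. -/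

import Mathlib

open scoped Manifold ContDiff Bundle

noncomputable section

/-! ## Vector fields, one-forms and endomorphism fields -/

/-- Vector fields on a manifold `M` modelled on `E` (no regularity is built in). -/
abbrev VecField (E : Type*) [NormedAddCommGroup E] [NormedSpace ℝ E]
    (M : Type*) [TopologicalSpace M] [ChartedSpace E M] : Type _ :=
  (x : M) → TangentSpace 𝓘(ℝ, E) x

/-- One-forms on `M`. -/
abbrev OneForm (E : Type*) [NormedAddCommGroup E] [NormedSpace ℝ E]
    (M : Type*) [TopologicalSpace M] [ChartedSpace E M] : Type _ :=
  (x : M) → TangentSpace 𝓘(ℝ, E) x →L[ℝ] ℝ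

/-- Fields of endomorphisms of the tangent spaces, i.e. tensor fields of type `(1,1)`. -/
abbrev EndoField (E : Type*) [NormedAddCommGroup E] [NormedSpace ℝ E]
    (M : Type*) [TopologicalSpace M] [ChartedSpace E M] : Type _ :=
  (x : M) → TangentSpace 𝓘(ℝ, E) x →L[ℝ] TangentSpace 𝓘(ℝ, E) x

/-- Distributions: a subspace of each tangent space. -/
abbrev TangentDistribution (E : Type*) [NormedAddCommGroup E] [NormedSpace ℝ E]
    (M : Type*) [TopologicalSpace M] [ChartedSpace E M] : Type _ :=
  (x : M) → Submodule ℝ (TangentSpace 𝓘(ℝ, E) x)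

section Smoothness

variable {E : Type*} [NormedAddCommGroup E] [NormedSpace ℝ E]
  {M : Type*} [TopologicalSpace M] [ChartedSpace E M] [IsManifold 𝓘(ℝ, E) ∞ M]

/-- `X` is a `C^∞` vector field, i.e. `X ∈ Γ(TM)`. -/
def IsSmoothVecField (X : VecField E M) : Prop :=
  ContMDiff 𝓘(ℝ, E) (𝓘(ℝ, E).prod 𝓘(ℝ, E)) ∞
    (fun x ↦ (⟨x, X x⟩ : TangentBundle 𝓘(ℝ, E) M))

/-- `η` is a `C^∞` one-form. -/
def IsSmoothOneForm (η : OneForm E M) : Prop :=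
  ContMDiff 𝓘(ℝ, E) (𝓘(ℝ, E).prod 𝓘(ℝ, E →L[ℝ] ℝ)) ∞
    (fun x ↦ Bundle.TotalSpace.mk' (E →L[ℝ] ℝ)
      (E := fun y : M ↦ TangentSpace 𝓘(ℝ, E) y →L[ℝ] Bundle.Trivial M ℝ y) x (η x))

/-- `φ` is a `C^∞` tensor field of type `(1,1)`. -/
def IsSmoothEndoField (φ : EndoField E M) : Prop :=
  ContMDiff 𝓘(ℝ, E) (𝓘(ℝ, E).prod 𝓘(ℝ, E →L[ℝ] E)) ∞
    (fun x ↦ Bundle.TotalSpace.mk' (E →L[ℝ] E)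
      (E := fun y : M ↦ TangentSpace 𝓘(ℝ, E) y →L[ℝ] TangentSpace 𝓘(ℝ, E) y) x (φ x))

end Smoothness

section Calculus

variable {E : Type*} [NormedAddCommGroup E] [NormedSpace ℝ E]
  {M : Type*} [TopologicalSpace M] [ChartedSpace E M]

/-- The Lie bracket `[X, Y]`. -/
def bracket (X Y : VecField E M) : VecField E M :=
  VectorField.mlieBracket 𝓘(ℝ, E) X Y

/-- The function `X f`, the derivative of `f` in the direction of `X`. -/
def lieDer (X : VecField E M) (f : M → ℝ) (x : M) : ℝ :=
  mvfderiv 𝓘(ℝ, E) f x (X x)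

/-- The endomorphism field `φ` applied to a vector field. -/
def EndoField.app (φ : EndoField E M) (X : VecField E M) : VecField E M :=
  fun x ↦ φ x (X x)

/-- `X (η Y) - Y (η X) - η [X, Y]`. This is `dη (X, Y)`, or `2 dη (X, Y)` in the convention in
which the exterior derivative of a one-form carries the factor `1/2`. -/
def dOne (η : OneForm E M) (X Y : VecField E M) (x : M) : ℝ :=
  lieDer X (fun y ↦ η y (Y y)) x - lieDer Y (fun y ↦ η y (X y)) x - η x (bracket X Y x)

/-- The exterior derivative of a two-form `Ω`, evaluated on three vector fields (up to the factor
`1/3` of one of the usual conventions). -/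
def dTwo (Ω : (x : M) → TangentSpace 𝓘(ℝ, E) x → TangentSpace 𝓘(ℝ, E) x → ℝ)
    (X Y Z : VecField E M) (x : M) : ℝ :=
  lieDer X (fun y ↦ Ω y (Y y) (Z y)) x + lieDer Y (fun y ↦ Ω y (Z y) (X y)) x
    + lieDer Z (fun y ↦ Ω y (X y) (Y y)) x
    - Ω x (bracket X Y x) (Z x) - Ω x (bracket Y Z x) (X x) - Ω x (bracket Z X x) (Y x)

/-- The Nijenhuis torsion `[φ, φ](X, Y) = φ² [X, Y] + [φ X, φ Y] - φ [φ X, Y] - φ [X, φ Y]`. -/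
def nijenhuis (φ : EndoField E M) (X Y : VecField E M) (x : M) : TangentSpace 𝓘(ℝ, E) x :=
  φ x (φ x (bracket X Y x)) + bracket (φ.app X) (φ.app Y) x
    - φ x (bracket (φ.app X) Y x) - φ x (bracket X (φ.app Y) x)

end Calculus

/-! ## Riemannian geometry

The Riemannian metric of `M` is Mathlib's: an inner product on each tangent space
(`Bundle.RiemannianBundle`) that depends smoothly on the point
(`IsContMDiffRiemannianBundle`). -/

section Riemannian

variable {E : Type*} [NormedAddCommGroup E] [NormedSpace ℝ E]
  {M : Type*} [TopologicalSpace M] [ChartedSpace E M]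

instance instFiniteDimensionalTangentSpaceModelSelf [FiniteDimensional ℝ E] (x : M) :
    FiniteDimensional ℝ (TangentSpace 𝓘(ℝ, E) x) :=
  inferInstanceAs (FiniteDimensional ℝ E)

variable [Bundle.RiemannianBundle (fun x : M ↦ TangentSpace 𝓘(ℝ, E) x)]

/-- The function `g (X, Y)`. -/
def metricFun (X Y : VecField E M) (x : M) : ℝ := inner ℝ (X x) (Y x)

/-- The right-hand side of the Koszul formula for `g (∇_X Y, Z)`. -/
def koszul (X Y Z : VecField E M) (x : M) : ℝ :=
  (1 / 2 : ℝ) *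
    (lieDer X (metricFun Y Z) x + lieDer Y (metricFun X Z) x - lieDer Z (metricFun X Y) x
      + inner ℝ (bracket X Y x) (Z x) - inner ℝ (bracket X Z x) (Y x)
      - inner ℝ (bracket Y Z x) (X x))

variable [IsManifold 𝓘(ℝ, E) ∞ M] [FiniteDimensional ℝ E]

/-- The Levi-Civita connection `∇_X Y`, given by the Koszul formula: the component of `∇_X Y` at
`x` along a member `b` of an orthonormal basis of `T_x M` is the Koszul expression for
`g (∇_X Y, Z)`, where `Z` is a local extension of `b`, smooth near `x` (the value does not depend
on the extension). -/
def leviCivita (X Y : VecField E M) : VecField E M := fun x ↦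
  ∑ i, koszul X Y
      (FiberBundle.extend E (stdOrthonormalBasis ℝ (TangentSpace 𝓘(ℝ, E) x) i)) x •
    stdOrthonormalBasis ℝ (TangentSpace 𝓘(ℝ, E) x) i

end Riemannian

/-! ## Almost contact metric structures and cosymplectic manifolds -/

section Contact

variable {E : Type*} [NormedAddCommGroup E] [NormedSpace ℝ E]
  {M : Type*} [TopologicalSpace M] [ChartedSpace E M] [IsManifold 𝓘(ℝ, E) ∞ M]
  [Bundle.RiemannianBundle (fun x : M ↦ TangentSpace 𝓘(ℝ, E) x)]

/-- `(φ, ξ, η, g)` is an almost contact metric structure on `M`, where `g` is the metric of `M`. -/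
structure IsAlmostContactMetric (φ : EndoField E M) (ξ : VecField E M) (η : OneForm E M) :
    Prop where
  smooth_phi : IsSmoothEndoField φ
  smooth_xi : IsSmoothVecField ξ
  smooth_eta : IsSmoothOneForm η
  phi_phi : ∀ (x : M) (v : TangentSpace 𝓘(ℝ, E) x), φ x (φ x v) = -v + η x v • ξ x
  phi_xi : ∀ x : M, φ x (ξ x) = 0
  eta_phi : ∀ (x : M) (v : TangentSpace 𝓘(ℝ, E) x), η x (φ x v) = 0
  eta_xi : ∀ x : M, η x (ξ x) = 1
  inner_phi_phi : ∀ (x : M) (v w : TangentSpace 𝓘(ℝ, E) x),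
    inner ℝ (φ x v) (φ x w) = inner ℝ v w - η x v * η x w
  eta_eq : ∀ (x : M) (v : TangentSpace 𝓘(ℝ, E) x), η x v = inner ℝ v (ξ x)

/-- The fundamental two-form `Φ (X, Y) = g (X, φ Y)`. -/
def fundamentalForm (φ : EndoField E M) (x : M) (v w : TangentSpace 𝓘(ℝ, E) x) : ℝ :=
  inner ℝ v (φ x w)

/-- `(φ, ξ, η, g)` is a cosymplectic structure: an almost contact metric structure that is normal,
`[φ, φ] + 2 dη ⊗ ξ = 0` (the factor `2` is part of `dOne`), with `η` and `Φ` closed. -/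
structure IsCosymplectic (φ : EndoField E M) (ξ : VecField E M) (η : OneForm E M) : Prop
    extends IsAlmostContactMetric φ ξ η where
  normal : ∀ X Y : VecField E M, IsSmoothVecField X → IsSmoothVecField Y →
    ∀ x : M, nijenhuis φ X Y x + dOne η X Y x • ξ x = 0
  eta_closed : ∀ X Y : VecField E M, IsSmoothVecField X → IsSmoothVecField Y →
    ∀ x : M, dOne η X Y x = 0
  fundamentalForm_closed : ∀ X Y Z : VecField E M,
    IsSmoothVecField X → IsSmoothVecField Y → IsSmoothVecField Z →
    ∀ x : M, dTwo (fundamentalForm φ) X Y Z x = 0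

end Contact

/-! ## Riemannian submersions and O'Neill's tensors -/

section Submersion

variable {E : Type*} [NormedAddCommGroup E] [NormedSpace ℝ E]
  {M : Type*} [TopologicalSpace M] [ChartedSpace E M]
  {E' : Type*} [NormedAddCommGroup E'] [NormedSpace ℝ E']
  {N : Type*} [TopologicalSpace N] [ChartedSpace E' N]

/-- The vertical distribution `ker F_*`. -/
def vertical (F : M → N) : TangentDistribution E M := fun x ↦
  (mfderiv 𝓘(ℝ, E) 𝓘(ℝ, E') F x).ker

variable [Bundle.RiemannianBundle (fun x : M ↦ TangentSpace 𝓘(ℝ, E) x)]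

/-- The horizontal distribution `(ker F_*)^⊥`. -/
def horizontal (F : M → N) : TangentDistribution E M := fun x ↦
  (vertical (E := E) (E' := E') F x)ᗮ

/-- `F` is a Riemannian submersion: smooth, onto, of maximal rank, and its differential preserves
the lengths of horizontal vectors. -/
structure IsRiemannianSubmersion
    [Bundle.RiemannianBundle (fun y : N ↦ TangentSpace 𝓘(ℝ, E') y)] (F : M → N) : Prop where
  smooth : ContMDiff 𝓘(ℝ, E) 𝓘(ℝ, E') ∞ F
  onto : Function.Surjective F
  maximal_rank : ∀ x : M, Function.Surjective (mfderiv 𝓘(ℝ, E) 𝓘(ℝ, E') F x)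
  norm_map : ∀ x : M, ∀ v ∈ horizontal (E := E) (E' := E') F x,
    ‖mfderiv 𝓘(ℝ, E) 𝓘(ℝ, E') F x v‖ = ‖v‖

/-- `F` is anti-invariant with respect to `φ`: `φ (ker F_*) ⊆ (ker F_*)^⊥`. -/
def IsAntiInvariant (φ : EndoField E M) (F : M → N) : Prop :=
  ∀ x : M, ∀ v ∈ vertical (E := E) (E' := E') F x, φ x v ∈ horizontal (E := E) (E' := E') F x

variable [FiniteDimensional ℝ E]

/-- The vertical part `𝒱 X` of a vector field. -/
def vertPart (E' : Type*) [NormedAddCommGroup E'] [NormedSpace ℝ E']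
    {N : Type*} [TopologicalSpace N] [ChartedSpace E' N] (F : M → N) (X : VecField E M) :
    VecField E M := fun x ↦ (vertical (E := E) (E' := E') F x).starProjection (X x)

/-- The horizontal part `ℋ X` of a vector field. -/
def horPart (E' : Type*) [NormedAddCommGroup E'] [NormedSpace ℝ E']
    {N : Type*} [TopologicalSpace N] [ChartedSpace E' N] (F : M → N) (X : VecField E M) :
    VecField E M := fun x ↦ (horizontal (E := E) (E' := E') F x).starProjection (X x)

variable [IsManifold 𝓘(ℝ, E) ∞ M]

/-- O'Neill's tensor `𝒯_X Y = ℋ ∇_{𝒱 X} 𝒱 Y + 𝒱 ∇_{𝒱 X} ℋ Y`. -/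
def oneillT (E' : Type*) [NormedAddCommGroup E'] [NormedSpace ℝ E']
    {N : Type*} [TopologicalSpace N] [ChartedSpace E' N] (F : M → N) (X Y : VecField E M) :
    VecField E M :=
  horPart E' F (leviCivita (vertPart E' F X) (vertPart E' F Y))
    + vertPart E' F (leviCivita (vertPart E' F X) (horPart E' F Y))

/-- O'Neill's tensor `𝒜_X Y = 𝒱 ∇_{ℋ X} ℋ Y + ℋ ∇_{ℋ X} 𝒱 Y`. -/
def oneillA (E' : Type*) [NormedAddCommGroup E'] [NormedSpace ℝ E']
    {N : Type*} [TopologicalSpace N] [ChartedSpace E' N] (F : M → N) (X Y : VecField E M) :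
    VecField E M :=
  vertPart E' F (leviCivita (horPart E' F X) (horPart E' F Y))
    + horPart E' F (leviCivita (horPart E' F X) (vertPart E' F Y))

end Submersion

/-- `X ∈ Γ(D)`: `X` is a smooth vector field with values in the distribution `D`. -/
def IsSmoothSectionOf {E : Type*} [NormedAddCommGroup E] [NormedSpace ℝ E]
    {M : Type*} [TopologicalSpace M] [ChartedSpace E M] [IsManifold 𝓘(ℝ, E) ∞ M]
    (D : TangentDistribution E M) (X : VecField E M) : Prop :=
  IsSmoothVecField X ∧ ∀ x : M, X x ∈ D x

/-! ## Local Riemannian products -/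

/-- `g` is a smooth Riemannian metric on the open set `U` of the vector space `V`. -/
structure IsMetricOn {V : Type*} [NormedAddCommGroup V] [NormedSpace ℝ V]
    (g : V → V →L[ℝ] V →L[ℝ] ℝ) (U : Set V) : Prop where
  isOpen : IsOpen U
  smooth : ContDiffOn ℝ ∞ g U
  symm : ∀ u ∈ U, ∀ v w : V, g u v w = g u w v
  pos : ∀ u ∈ U, ∀ v : V, v ≠ 0 → 0 < g u v v

/-- `M` is a locally product manifold with respect to the pair of distributions `D₁`, `D₂`: each
point of `M` has an open neighbourhood (the source of `e`) that is isometric to a product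
`(U₁, g₁) × (U₂, g₂)` of Riemannian manifolds, in such a way that `D₁` and `D₂` are the tangent
distributions of the first and of the second factor. As the notion is local, the factors can be
taken to be open sets of Euclidean spaces with arbitrary smooth Riemannian metrics. -/
def IsLocallyProduct {E : Type*} [NormedAddCommGroup E] [NormedSpace ℝ E]
    {M : Type*} [TopologicalSpace M] [ChartedSpace E M]
    [Bundle.RiemannianBundle (fun x : M ↦ TangentSpace 𝓘(ℝ, E) x)]
    (D₁ D₂ : TangentDistribution E M) : Prop :=
  ∀ p : M, ∃ (k l : ℕ)
    (U₁ : Set (EuclideanSpace ℝ (Fin k))) (U₂ : Set (EuclideanSpace ℝ (Fin l)))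
    (g₁ : EuclideanSpace ℝ (Fin k) →
      EuclideanSpace ℝ (Fin k) →L[ℝ] EuclideanSpace ℝ (Fin k) →L[ℝ] ℝ)
    (g₂ : EuclideanSpace ℝ (Fin l) →
      EuclideanSpace ℝ (Fin l) →L[ℝ] EuclideanSpace ℝ (Fin l) →L[ℝ] ℝ)
    (e : OpenPartialHomeomorph M (EuclideanSpace ℝ (Fin k) × EuclideanSpace ℝ (Fin l))),
    IsMetricOn g₁ U₁ ∧ IsMetricOn g₂ U₂ ∧
    p ∈ e.source ∧ e.target = U₁ ×ˢ U₂ ∧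
    ContMDiffOn 𝓘(ℝ, E) 𝓘(ℝ, EuclideanSpace ℝ (Fin k) × EuclideanSpace ℝ (Fin l)) ∞
      e e.source ∧
    ContMDiffOn 𝓘(ℝ, EuclideanSpace ℝ (Fin k) × EuclideanSpace ℝ (Fin l)) 𝓘(ℝ, E) ∞
      e.symm e.target ∧
    ∀ x ∈ e.source,
      (∀ v : TangentSpace 𝓘(ℝ, E) x, v ∈ D₁ x ↔ (mvfderiv 𝓘(ℝ, E) e x v).2 = 0) ∧
      (∀ v : TangentSpace 𝓘(ℝ, E) x, v ∈ D₂ x ↔ (mvfderiv 𝓘(ℝ, E) e x v).1 = 0) ∧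
      ∀ v w : TangentSpace 𝓘(ℝ, E) x,
        inner ℝ v w =
          g₁ (e x).1 (mvfderiv 𝓘(ℝ, E) e x v).1 (mvfderiv 𝓘(ℝ, E) e x w).1
            + g₂ (e x).2 (mvfderiv 𝓘(ℝ, E) e x v).2 (mvfderiv 𝓘(ℝ, E) e x w).2

end

/-!
The theorem reduces to statements about the distributions `𝒱 = ker F_*` and `ℋ = 𝒱ᗮ`.

*The tensors.* The splitting of `ℋ` says that `φ` maps `𝒱` into `ℋ` and `ℋ` into `𝒱`
(`IsAlmostContactMetric.exchangesFibres`). So `φ Y` is vertical for horizontal `Y`, and `𝒜_X (φ Y)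
= ℋ ∇_X (φ Y)`; in the same way `𝒯_V (φ W) = 𝒱 ∇_V (φ W)`. Every vertical field `W` is `φ (-φ W)`,
hence vanishing of all `𝒜_X (φ Y)` means that `∇_X` preserves vertical fields for horizontal `X`,
which makes `ℋ` involutive (`IsAlmostContactMetric.inner_bracket_eq_zero`). A horizontal field `Z`
is `φ (-φ Z) + η (Z) ξ`, so vanishing of all `𝒯_V (φ W)` makes the fibres totally geodesic as soon
as `g (∇_V U, ξ) = 0` for vertical `V`, `U`; this is the only place where the cosymplectic
condition enters: normality and `dΦ = 0` give `(L_ξ g) (V, U) = 0`, and `dη = 0` gives `η [V, U] =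
0` (`IsCosymplectic.koszul_xi`, `IsCosymplectic.koszul_eq_zero`).

*From a product to the tensors.* On a local product, differentiation along one factor preserves the
fields tangent to the other one, which is read off the Koszul formula in terms of the two
projections (`IsLocallyProduct.inner_leviCivita_eq_zero`).

*From the tensors to a product.* This holds for every Riemannian submersion with involutive `ℋ` and
totally geodesic fibres (`IsRiemannianSubmersion.isLocallyProduct`). In a chart with values in `X ×
Y` whose first component factors through `F`, the vertical spaces are `{0} × Y` and the horizontal
spaces are the graphs of a connection form `A : X × Y → (X →L[ℝ] Y)`. Involutivity makes `A` flat,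
and by the Frobenius theorem for graphs (`exists_firstIntegral`) there are `Y`-valued first
integrals of `ℋ`; taken as new coordinates, they straighten both distributions
(`IsAdaptedChart.exists_productChart`). The two distributions are orthogonal. The metric of `ℋ`
depends on the `X`-coordinate alone, because `F` is a Riemannian submersion; the metric of `𝒱` is
independent of the `X`-coordinate, because `g (∇_V U, Z) = - (1/2) Z (g (V, U))` for coordinate
fields `V`, `U` vertical and `Z` horizontal.

The Frobenius theorem is proved by transport along segments towards a fixed point. Smooth
dependence of the transport on its initial point comes from the inverse function theorem in the
Banach space `C([0, 1], Y)`, where the superposition operators `u ↦ f ∘ u` of smooth maps are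
smooth (`contDiff_superposition`).
-/

noncomputable section

open Set Filter Topology

/-! ### Superposition operators on spaces of continuous maps -/

section Superposition

universe u

variable {K : Type*} [TopologicalSpace K] [CompactSpace K]
  {W Z : Type u} [NormedAddCommGroup W] [NormedSpace ℝ W]
  [NormedAddCommGroup Z] [NormedSpace ℝ Z]

/-- The pointwise application of a continuous bilinear map `B : A → W → Z`, as a continuous bilinear
map `C(K, A) → C(K, W) → C(K, Z)`. -/
def pointwiseBilin (K : Type*) [TopologicalSpace K] [CompactSpace K] {A W Z : Type*}
    [NormedAddCommGroup A] [NormedSpace ℝ A] [NormedAddCommGroup W] [NormedSpace ℝ W]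
    [NormedAddCommGroup Z] [NormedSpace ℝ Z] (B : A →L[ℝ] W →L[ℝ] Z) :
    C(K, A) →L[ℝ] C(K, W) →L[ℝ] C(K, Z) :=
  LinearMap.mkContinuous₂
    (LinearMap.mk₂ ℝ (fun (T : C(K, A)) (h : C(K, W)) ↦
        (⟨fun t ↦ B (T t) (h t), by fun_prop⟩ : C(K, Z)))
      (fun _ _ _ ↦ by ext; simp) (fun _ _ _ ↦ by ext; simp)
      (fun _ _ _ ↦ by ext; simp) (fun _ _ _ ↦ by ext; simp)) ‖B‖ fun T h ↦ by
    rw [ContinuousMap.norm_le _ (by positivity)]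
    intro t
    refine (B.le_opNorm₂ _ _).trans ?_
    gcongr
    · exact T.norm_coe_le_norm t
    · exact h.norm_coe_le_norm t

@[simp]
lemma pointwiseBilin_apply {A : Type*} [NormedAddCommGroup A] [NormedSpace ℝ A]
    (B : A →L[ℝ] W →L[ℝ] Z) (T : C(K, A)) (h : C(K, W)) (t : K) :
    pointwiseBilin K B T h t = B (T t) (h t) := rfl

/-- The superposition operator `u ↦ f ∘ u` of a `C¹` map `f` is differentiable; the estimate of the
remainder is uniform because the range of `u` is compact. -/
lemma hasFDerivAt_superposition {f : W → Z} {f' : W → W →L[ℝ] Z} (hf' : Continuous f')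
    (hf : ∀ x, HasFDerivAt f (f' x) x) (hfc : Continuous f) (u : C(K, W)) :
    HasFDerivAt (fun v : C(K, W) ↦ (⟨f, hfc⟩ : C(W, Z)).comp v)
      (pointwiseBilin K (.id ℝ (W →L[ℝ] Z)) ((⟨f', hf'⟩ : C(W, W →L[ℝ] Z)).comp u)) u := by
  rw [hasFDerivAt_iff_isLittleO_nhds_zero, Asymptotics.isLittleO_iff]
  intro ε hε
  have hc : IsCompact (range u) := isCompact_range u.continuous
  have key := hc.uniformContinuousAt_of_continuousAt f' (fun a _ ↦ hf'.continuousAt)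
    (Metric.dist_mem_uniformity hε)
  obtain ⟨δ, hδ, hδ'⟩ := Metric.mem_uniformity_dist.1 key
  filter_upwards [Metric.ball_mem_nhds (0 : C(K, W)) hδ] with h hh
  rw [ContinuousMap.norm_le _ (by positivity)]
  intro t
  have hht : ‖h t‖ < δ := (h.norm_coe_le_norm t).trans_lt (by simpa using hh)
  have hb : ∀ x ∈ Metric.ball (u t) δ, ‖f' x - f' (u t)‖ ≤ ε := by
    intro x hx
    have := hδ' (a := u t) (b := x) (by rwa [Metric.mem_ball, dist_comm] at hx) (mem_range_self t)
    simp only [mem_ofPred_eq] at this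
    rw [← dist_eq_norm, dist_comm]
    exact this.le
  have := (convex_ball (u t) δ).norm_image_sub_le_of_norm_hasFDerivWithin_le'
    (fun x _ ↦ (hf x).hasFDerivWithinAt) hb (Metric.mem_ball_self hδ)
    (show u t + h t ∈ Metric.ball (u t) δ by simpa using hht)
  simp only [add_sub_cancel_left] at this
  simpa using this.trans (mul_le_mul_of_nonneg_left (h.norm_coe_le_norm t) hε.le)

set_option synthInstance.maxHeartbeats 200000 in
lemma contDiff_superposition_nat (n : ℕ) : ∀ {Z : Type u} [NormedAddCommGroup Z] [NormedSpace ℝ Z]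
    {f : W → Z} (hf : ContDiff ℝ n f),
    ContDiff ℝ n (fun v : C(K, W) ↦ (⟨f, hf.continuous⟩ : C(W, Z)).comp v) := by
  induction n with
  | zero =>
    intro Z _ _ f hf
    exact contDiff_zero.2 (ContinuousMap.continuous_postcomp _)
  | succ n ih =>
    intro Z _ _ f hf
    obtain ⟨f', hf', hff'⟩ := contDiff_succ_iff_hasFDerivAt.1 hf
    refine contDiff_succ_iff_hasFDerivAt.2 ⟨fun u ↦ pointwiseBilin K (.id ℝ (W →L[ℝ] Z))
      ((⟨f', hf'.continuous⟩ : C(W, W →L[ℝ] Z)).comp u), ?_, fun u ↦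
      hasFDerivAt_superposition hf'.continuous hff' hf.continuous u⟩
    exact (pointwiseBilin K (.id ℝ (W →L[ℝ] Z))).contDiff.comp (ih hf')

/-- The superposition operator of a smooth map is smooth. -/
lemma contDiff_superposition {f : W → Z} (hf : ContDiff ℝ ∞ f) :
    ContDiff ℝ ∞ (fun v : C(K, W) ↦ (⟨f, hf.continuous⟩ : C(W, Z)).comp v) :=
  contDiff_infty.2 fun n ↦ contDiff_superposition_nat n (contDiff_infty.1 hf n)

end Superposition

/-! ### The inverse function theorem for smooth maps -/

/-- A smooth map whose derivative at `a` is invertible restricts to a diffeomorphism between open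
sets. -/
lemma exists_openPartialHomeomorph_of_contDiffOn {V₁ V₂ : Type*}
    [NormedAddCommGroup V₁] [NormedSpace ℝ V₁] [CompleteSpace V₁]
    [NormedAddCommGroup V₂] [NormedSpace ℝ V₂] [CompleteSpace V₂] {f : V₁ → V₂} {U : Set V₁}
    (hU : IsOpen U) (hf : ContDiffOn ℝ ∞ f U) {a : V₁} (ha : a ∈ U) (f' : V₁ ≃L[ℝ] V₂)
    (hf' : HasFDerivAt f (f' : V₁ →L[ℝ] V₂) a) :
    ∃ e : OpenPartialHomeomorph V₁ V₂, (∀ x, e x = f x) ∧ a ∈ e.source ∧ e.source ⊆ U ∧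
      ContDiffOn ℝ ∞ e.symm e.target := by
  have hfa : ContDiffAt ℝ ∞ f a := hf.contDiffAt (hU.mem_nhds ha)
  set e₀ := hfa.toOpenPartialHomeomorph f hf' (by simp)
  have he₀ : ∀ x, e₀ x = f x := fun x ↦ rfl
  -- the derivative stays invertible on an open set
  have hcont : ContinuousOn (fderiv ℝ f) U := hf.continuousOn_fderiv_of_isOpen hU (by simp)
  set S : Set V₁ := U ∩ fderiv ℝ f ⁻¹' (range ((↑) : (V₁ ≃L[ℝ] V₂) → V₁ →L[ℝ] V₂))
  have hS : IsOpen S := hcont.isOpen_inter_preimage hU (ContinuousLinearEquiv.isOpen)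
  refine ⟨e₀.restrOpen S hS, fun x ↦ rfl, ?_, ?_, ?_⟩
  · refine ⟨ContDiffAt.mem_toOpenPartialHomeomorph_source hfa hf' (by simp), ha, f', ?_⟩
    exact hf'.fderiv.symm
  · intro x hx
    rw [OpenPartialHomeomorph.restrOpen_source] at hx
    exact hx.2.1
  · intro y hy
    have hx := (e₀.restrOpen S hS).map_target hy
    rw [OpenPartialHomeomorph.restrOpen_source] at hx
    obtain ⟨hxU, g, hg⟩ := hx.2
    have hfx := hf.contDiffAt (hU.mem_nhds hxU)
    refine ((e₀.restrOpen S hS).contDiffAt_symm hy (f₀' := g) ?_ hfx).contDiffWithinAt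
    rw [hg]
    exact (hfx.differentiableAt (by simp)).hasFDerivAt

/-! ### First integrals of a flat graph distribution -/

section Frobenius

/-- The operator `h ↦ (t ↦ ∫₀ᵗ h)` on continuous maps on `[0, 1]`. -/
def integralOperator (Y : Type*) [NormedAddCommGroup Y] [NormedSpace ℝ Y] :
    C(Icc (0 : ℝ) 1, Y) →L[ℝ] C(Icc (0 : ℝ) 1, Y) :=
  LinearMap.mkContinuous
    { toFun := fun h ↦ ⟨fun t ↦ ∫ s in (0 : ℝ)..t, IccExtend zero_le_one h s, by
        have : Continuous fun t : ℝ ↦ ∫ s in (0 : ℝ)..t, IccExtend zero_le_one h s :=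
          intervalIntegral.continuous_primitive
            (fun a b ↦ (h.continuous.Icc_extend').intervalIntegrable a b) 0
        exact this.comp continuous_subtype_val⟩
      map_add' := fun h k ↦ by
        ext t
        exact intervalIntegral.integral_add ((h.continuous.Icc_extend').intervalIntegrable _ _)
          ((k.continuous.Icc_extend').intervalIntegrable _ _)
      map_smul' := fun c h ↦ by
        ext t
        exact intervalIntegral.integral_smul c _ } 1 fun h ↦ by
    rw [ContinuousMap.norm_le _ (by positivity)]
    intro t
    refine (intervalIntegral.norm_integral_le_of_norm_le_const
      (fun s _ ↦ h.norm_coe_le_norm (projIcc 0 1 zero_le_one s))).trans ?_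
    rw [one_mul, sub_zero, abs_of_nonneg t.2.1]
    exact mul_le_of_le_one_right (norm_nonneg _) t.2.2

lemma hasDerivAt_integral_IccExtend {Y : Type*} [NormedAddCommGroup Y] [NormedSpace ℝ Y]
    [CompleteSpace Y] (h : C(Icc (0 : ℝ) 1, Y)) (t : ℝ) :
    HasDerivAt (fun t ↦ ∫ s in (0 : ℝ)..t, IccExtend zero_le_one h s)
      (IccExtend zero_le_one h t) t :=
  intervalIntegral.integral_hasDerivAt_right
    ((h.continuous.Icc_extend').intervalIntegrable _ _)
    (h.continuous.Icc_extend').stronglyMeasurable.stronglyMeasurableAtFilter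
    (h.continuous.Icc_extend').continuousAt

universe u

variable {X Y : Type u} [NormedAddCommGroup X] [NormedSpace ℝ X] [FiniteDimensional ℝ X]
  [NormedAddCommGroup Y] [NormedSpace ℝ Y]

/-- The linear part of `rayCurve`. -/
def rayCurveLinear (X Y : Type u) [NormedAddCommGroup X] [NormedSpace ℝ X] [FiniteDimensional ℝ X]
    [NormedAddCommGroup Y] [NormedSpace ℝ Y] :
    (X × Y) × C(Icc (0 : ℝ) 1, Y) →L[ℝ] C(Icc (0 : ℝ) 1, X × X × Y) :=
  (LinearMap.toContinuousLinearMap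
    { toFun := fun x : X ↦ (⟨fun t : Icc (0 : ℝ) 1 ↦ (-x, (1 - (t : ℝ)) • x, (0 : Y)),
        by fun_prop⟩ : C(Icc (0 : ℝ) 1, X × X × Y))
      map_add' := fun x y ↦ by ext t <;> simp [add_comm]
      map_smul' := fun c x ↦ by
        ext t
        · simp
        · simp [smul_smul, mul_comm]
        · simp }) ∘L
      (ContinuousLinearMap.fst ℝ X Y) ∘L
      (ContinuousLinearMap.fst ℝ (X × Y) C(Icc (0 : ℝ) 1, Y)) +
  (((ContinuousLinearMap.inr ℝ X (X × Y)) ∘L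
    (ContinuousLinearMap.inr ℝ X Y)).compLeftContinuous ℝ (Icc (0 : ℝ) 1)) ∘L
      (ContinuousLinearMap.snd ℝ (X × Y) C(Icc (0 : ℝ) 1, Y))

lemma rayCurveLinear_apply (p : (X × Y) × C(Icc (0 : ℝ) 1, Y)) (t : Icc (0 : ℝ) 1) :
    rayCurveLinear X Y p t = (-p.1.1, (1 - (t : ℝ)) • p.1.1, p.2 t) := by
  simp [rayCurveLinear]

/-- The curve `t ↦ (x₀ - x, (1 - t) x + t x₀, u t)` in `X × X × Y`: velocity and position of the
segment from `x` to `x₀`, together with a curve `u` in `Y`. -/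
def rayCurve (x₀ : X) (p : (X × Y) × C(Icc (0 : ℝ) 1, Y)) : C(Icc (0 : ℝ) 1, X × X × Y) :=
  (⟨fun t : Icc (0 : ℝ) 1 ↦ (x₀, (t : ℝ) • x₀, (0 : Y)), by fun_prop⟩ :
    C(Icc (0 : ℝ) 1, X × X × Y)) + rayCurveLinear X Y p

lemma rayCurve_apply (x₀ : X) (p : (X × Y) × C(Icc (0 : ℝ) 1, Y)) (t : Icc (0 : ℝ) 1) :
    rayCurve x₀ p t = (x₀ - p.1.1, (t : ℝ) • x₀ + (1 - (t : ℝ)) • p.1.1, p.2 t) := by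
  simp [rayCurve, rayCurveLinear_apply, sub_eq_add_neg]

lemma contDiff_rayCurve (x₀ : X) : ContDiff ℝ ∞ (rayCurve (Y := Y) x₀) :=
  contDiff_const.add (rayCurveLinear X Y).contDiff

lemma hasFDerivAt_rayCurve (x₀ : X) (p : (X × Y) × C(Icc (0 : ℝ) 1, Y)) :
    HasFDerivAt (rayCurve x₀) (rayCurveLinear X Y) p :=
  (rayCurveLinear X Y).hasFDerivAt.const_add _

variable [FiniteDimensional ℝ Y]

/-- Smooth dependence on the initial point of the transport equation
`u' = f (x₀ - x, (1 - t) x + t x₀, u)`, `u 0 = y`. Since `f` vanishes when its first argument does,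
the solution for `x = x₀` is constant, and the implicit function theorem in the space of
continuous curves provides the solutions for nearby `(x, y)` on the whole of `[0, 1]`. -/
lemma exists_smooth_transport {f : X × X × Y → Y} (hf : ContDiff ℝ ∞ f)
    (hf0 : ∀ q, f (0, q) = 0) (z₀ : X × Y) :
    ∃ (O : Set (X × Y)) (ψ : X × Y → C(Icc (0 : ℝ) 1, Y)), IsOpen O ∧ z₀ ∈ O ∧
      ContDiffOn ℝ ∞ ψ O ∧ ψ z₀ = ContinuousMap.const _ z₀.2 ∧
      ∀ z ∈ O, ψ z = ContinuousMap.const _ z.2 +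
        integralOperator Y ((⟨f, hf.continuous⟩ : C(X × X × Y, Y)).comp
          (rayCurve z₀.1 (z, ψ z))) := by
  set N : C(Icc (0 : ℝ) 1, X × X × Y) → C(Icc (0 : ℝ) 1, Y) :=
    fun v ↦ (⟨f, hf.continuous⟩ : C(X × X × Y, Y)).comp v with hN
  have hNs : ContDiff ℝ ∞ N := contDiff_superposition hf
  set Q : (X × Y) × C(Icc (0 : ℝ) 1, Y) → C(Icc (0 : ℝ) 1, Y) := fun p ↦
    p.2 - ContinuousLinearMap.const ℝ (Icc (0 : ℝ) 1) p.1.2 -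
      integralOperator Y (N (rayCurve z₀.1 p)) with hQ
  have hQs : ContDiff ℝ ∞ Q := by
    refine (contDiff_snd.sub ?_).sub ?_
    · exact (ContinuousLinearMap.const ℝ (Icc (0 : ℝ) 1) :
        Y →L[ℝ] C(Icc (0 : ℝ) 1, Y)).contDiff.comp (contDiff_snd.comp contDiff_fst)
    · exact (integralOperator Y).contDiff.comp (hNs.comp (contDiff_rayCurve _))
  have hQ0 : ∀ (y : Y) (u : C(Icc (0 : ℝ) 1, Y)),
      Q ((z₀.1, y), u) = u - ContinuousMap.const _ y := by
    intro y u
    have : N (rayCurve z₀.1 ((z₀.1, y), u)) = 0 := by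
      ext t
      simp [hN, rayCurve_apply, hf0]
    simp only [hQ, this, map_zero, sub_zero]
    rfl
  set u₀ : C(Icc (0 : ℝ) 1, Y) := ContinuousMap.const _ z₀.2 with hu₀
  obtain ⟨Q', hQ'⟩ : ∃ Q', HasFDerivAt Q Q' (z₀, u₀) :=
    ⟨_, (hQs.differentiable (by simp) _).hasFDerivAt⟩
  have hQ'u : ∀ v, Q' (0, v) = v := by
    intro v
    have h1 : HasFDerivAt (fun u ↦ Q (z₀, u))
        (Q' ∘L ContinuousLinearMap.inr ℝ (X × Y) C(Icc (0 : ℝ) 1, Y)) u₀ :=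
      hQ'.comp u₀ (hasFDerivAt_prodMk_right z₀ u₀)
    have h2 : HasFDerivAt (fun u ↦ Q (z₀, u)) (.id ℝ C(Icc (0 : ℝ) 1, Y)) u₀ := by
      have : (fun u ↦ Q (z₀, u)) = fun u ↦ u - u₀ := funext fun u ↦ hQ0 z₀.2 u
      rw [this]
      exact (hasFDerivAt_id u₀).sub_const _
    simpa using congrArg (fun T ↦ T v) (h1.unique h2)
  set T : ((X × Y) × C(Icc (0 : ℝ) 1, Y)) ≃L[ℝ] (X × Y) × C(Icc (0 : ℝ) 1, Y) :=
    (ContinuousLinearEquiv.refl ℝ (X × Y)).skewProd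
      (ContinuousLinearEquiv.refl ℝ C(Icc (0 : ℝ) 1, Y))
      (Q' ∘L ContinuousLinearMap.inl ℝ (X × Y) C(Icc (0 : ℝ) 1, Y)) with hT
  have hΦ : HasFDerivAt (fun p : (X × Y) × C(Icc (0 : ℝ) 1, Y) ↦ (p.1, Q p))
      (T : _ →L[ℝ] (X × Y) × C(Icc (0 : ℝ) 1, Y)) (z₀, u₀) := by
    convert! (hasFDerivAt_fst (𝕜 := ℝ)).prodMk hQ' using 1
    refine ContinuousLinearMap.ext fun p ↦ Prod.ext ?_ ?_
    · simp [hT]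
    · have : Q' p = p.2 + Q' (p.1, 0) := by
        conv_rhs => rw [← hQ'u p.2]
        rw [← map_add]
        simp
      simp [hT, this]
  obtain ⟨e, he, hmem, -, hsymm⟩ := exists_openPartialHomeomorph_of_contDiffOn isOpen_univ
    ((contDiff_fst.prodMk hQs).contDiffOn) (mem_univ (z₀, u₀)) T hΦ
  have he0 : e (z₀, u₀) = (z₀, 0) := by
    rw [he]
    ext1
    · rfl
    · exact (hQ0 z₀.2 u₀).trans (by rw [← hu₀, sub_self])
  have hinv : ContDiff ℝ ∞ fun z : X × Y ↦ (z, (0 : C(Icc (0 : ℝ) 1, Y))) :=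
    contDiff_id.prodMk contDiff_const
  refine ⟨(fun z ↦ (z, (0 : C(Icc (0 : ℝ) 1, Y)))) ⁻¹' e.target, fun z ↦ (e.symm (z, 0)).2,
    e.open_target.preimage hinv.continuous, ?_, ?_, ?_, ?_⟩
  · rw [mem_preimage, ← he0]
    exact e.map_source hmem
  · exact (hsymm.comp hinv.contDiffOn (fun z hz ↦ hz)).snd
  · simp only
    rw [← he0, e.left_inv hmem]
  · intro z hz
    have h1 := e.right_inv hz
    rw [he] at h1
    have h2 : (e.symm (z, 0)).1 = z := congrArg Prod.fst h1
    have h3 : Q (e.symm (z, 0)) = 0 := congrArg Prod.snd h1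
    have h4 : e.symm (z, 0) = (z, (e.symm (z, 0)).2) := Prod.ext h2 rfl
    rw [h4] at h3
    simp only [hQ, sub_eq_zero] at h3
    exact (add_sub_cancel _ _).symm.trans (congrArg (ContinuousMap.const _ z.2 + ·) h3)

lemma exists_norm_le_of_continuous_clm {W Z : Type*} [NormedAddCommGroup W] [NormedSpace ℝ W]
    [NormedAddCommGroup Z] [NormedSpace ℝ Z] {D : ℝ → W →L[ℝ] Z} (hD : Continuous D) (a b : ℝ) :
    ∃ C, ∀ t ∈ Icc a b, ‖D t‖ ≤ C :=
  isCompact_Icc.exists_bound_of_continuousOn hD.continuousOn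

/-- Backward transport along segments is a first integral of the distribution spanned by the vectors
`(c, A z c)`, if that distribution is flat near `z₀`. If `U` is the variation of the transported
curve `q = (p, u)` in the direction `(c, A z c)`, then `w t = U t - (1 - t) A (q t) c` solves a
linear equation by flatness, and `w 0 = 0`; hence `U 1 = w 1 = 0`. -/
lemma exists_firstIntegral_of_contDiff {A : X × Y → X →L[ℝ] Y} (hA : ContDiff ℝ ∞ A) {z₀ : X × Y}
    {r : ℝ} (hr : 0 < r)
    (hflat : ∀ z ∈ Metric.ball z₀ r, ∀ a b : X,
      fderiv ℝ A z (a, A z a) b = fderiv ℝ A z (b, A z b) a) :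
    ∃ (O : Set (X × Y)) (G : X × Y → Y), IsOpen O ∧ z₀ ∈ O ∧ ContDiffOn ℝ ∞ G O ∧
      (∀ z ∈ O, ∀ c : X, fderiv ℝ G z (c, A z c) = 0) ∧
      ∀ b : Y, fderiv ℝ G z₀ (0, b) = b := by
  set f : X × X × Y → Y := fun q ↦ A q.2 q.1 with hf_def
  have hf : ContDiff ℝ ∞ f := (hA.comp contDiff_snd).clm_apply contDiff_fst
  have hAd : Differentiable ℝ A := hA.differentiable (by simp)
  obtain ⟨O, ψ, hO, hz₀, hψ, hψ₀, hψeq⟩ :=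
    exists_smooth_transport hf (fun q ↦ by simp [hf_def]) z₀
  set O' : Set (X × Y) := (O ∩ ψ ⁻¹' Metric.ball (ContinuousMap.const _ z₀.2) r) ∩
    Metric.ball z₀ r with hO'
  have hO'o : IsOpen O' :=
    (hψ.continuousOn.isOpen_inter_preimage hO Metric.isOpen_ball).inter Metric.isOpen_ball
  have hz₀' : z₀ ∈ O' := by
    refine ⟨⟨hz₀, ?_⟩, Metric.mem_ball_self hr⟩
    rw [mem_preimage, hψ₀]
    exact Metric.mem_ball_self hr
  set one : Icc (0 : ℝ) 1 := ⟨1, by simp⟩ with hone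
  set ev : C(Icc (0 : ℝ) 1, Y) →L[ℝ] Y := ContinuousMap.evalCLM ℝ one with hev
  have hψd : ∀ z ∈ O, HasFDerivAt ψ (fderiv ℝ ψ z) z := fun z hz ↦
    ((hψ.contDiffAt (hO.mem_nhds hz)).differentiableAt (by simp)).hasFDerivAt
  have hGd : ∀ z ∈ O, HasFDerivAt (fun z ↦ ev (ψ z)) (ev ∘L fderiv ℝ ψ z) z := fun z hz ↦
    ev.hasFDerivAt.comp z (hψd z hz)
  refine ⟨O', fun z ↦ ev (ψ z), hO'o, hz₀',
    ev.contDiff.comp_contDiffOn (hψ.mono fun z hz ↦ hz.1.1), ?_, ?_⟩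
  · intro z hz c
    rw [(hGd z hz.1.1).fderiv]
    set U : C(Icc (0 : ℝ) 1, Y) := fderiv ℝ ψ z (c, A z c) with hU
    change U one = 0
    -- `q` is the transported curve, `m` its velocity, `k` the velocity of the variation `U`
    set q : C(Icc (0 : ℝ) 1, X × X × Y) := rayCurve z₀.1 (z, ψ z) with hq
    set m : C(Icc (0 : ℝ) 1, Y) := (⟨f, hf.continuous⟩ : C(X × X × Y, Y)).comp q with hm
    have hf' : Continuous (fderiv ℝ f) := hf.continuous_fderiv (by simp)
    have hfd : ∀ x, HasFDerivAt f (fderiv ℝ f x) x := fun x ↦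
      (hf.differentiable (by simp) x).hasFDerivAt
    set k : C(Icc (0 : ℝ) 1, Y) := pointwiseBilin (Icc (0 : ℝ) 1) (.id ℝ (X × X × Y →L[ℝ] Y))
      ((⟨fderiv ℝ f, hf'⟩ : C(X × X × Y, X × X × Y →L[ℝ] Y)).comp q)
      (rayCurveLinear X Y ((c, A z c), U)) with hk
    have hUeq : U = ContinuousMap.const _ (A z c) + integralOperator Y k := by
      have h1 : HasFDerivAt (fun z' ↦ (z', ψ z'))
          ((ContinuousLinearMap.id ℝ (X × Y)).prod (fderiv ℝ ψ z)) z :=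
        (hasFDerivAt_id z).prodMk (hψd z hz.1.1)
      have h2 := (hasFDerivAt_rayCurve z₀.1 (z, ψ z)).comp z h1
      have h3 := (hasFDerivAt_superposition hf' hfd hf.continuous q).comp z h2
      have h4 := (integralOperator Y).hasFDerivAt.comp z h3
      have h5 := ((ContinuousLinearMap.const ℝ (Icc (0 : ℝ) 1) :
        Y →L[ℝ] C(Icc (0 : ℝ) 1, Y)) ∘L ContinuousLinearMap.snd ℝ X Y).hasFDerivAt (x := z)
      have h6 := (h5.add h4).congr_of_eventuallyEq
        (f₁ := ψ) (by filter_upwards [hO.mem_nhds hz.1.1] with z' hz' using hψeq z' hz')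
      rw [hU, (hψd z hz.1.1).unique h6]
      rfl
    have hfd' : ∀ (v a : X) (p d : X × Y), fderiv ℝ f (v, p) (a, d) =
        A p a + fderiv ℝ A p d v := by
      intro v a p d
      have h1 : HasFDerivAt (fun q : X × X × Y ↦ A q.2)
          ((fderiv ℝ A p) ∘L ContinuousLinearMap.snd ℝ X (X × Y)) (v, p) :=
        (hAd p).hasFDerivAt.comp (v, p) hasFDerivAt_snd
      have h2 := h1.clm_apply (hasFDerivAt_fst (p := (v, p)))
      rw [show f = fun q : X × X × Y ↦ A q.2 q.1 from rfl, h2.fderiv]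
      simp
    -- extend the curves to the real line
    set ũ : ℝ → Y := fun t ↦ z.2 + ∫ s in (0 : ℝ)..t, IccExtend zero_le_one m s with hũ
    set Ũ : ℝ → Y := fun t ↦ A z c + ∫ s in (0 : ℝ)..t, IccExtend zero_le_one k s with hŨ
    set q' : ℝ → X × Y := fun t ↦ (t • z₀.1 + (1 - t) • z.1, ũ t) with hq'
    have hũe : ∀ t : Icc (0 : ℝ) 1, ψ z t = ũ t := fun t ↦
      congrArg (fun h : C(Icc (0 : ℝ) 1, Y) ↦ h t) (hψeq z hz.1.1)
    have hŨe : ∀ t : Icc (0 : ℝ) 1, U t = Ũ t := fun t ↦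
      congrArg (fun h : C(Icc (0 : ℝ) 1, Y) ↦ h t) hUeq
    have hqe : ∀ t : Icc (0 : ℝ) 1, q t = (z₀.1 - z.1, q' t) := fun t ↦ by
      rw [hq, rayCurve_apply, hq', hũe]
    have hqball : ∀ t ∈ Icc (0 : ℝ) 1, q' t ∈ Metric.ball z₀ r := by
      intro t ht
      have hx : dist z.1 z₀.1 < r :=
        lt_of_le_of_lt (le_max_left _ _) (Metric.mem_ball.1 hz.2)
      have hy : dist (ψ z ⟨t, ht⟩) z₀.2 < r :=
        lt_of_le_of_lt (ContinuousMap.dist_apply_le_dist (g := ContinuousMap.const _ z₀.2) _)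
          (Metric.mem_ball.1 hz.1.2)
      rw [Metric.mem_ball, Prod.dist_eq]
      refine max_lt ?_ ?_
      · refine lt_of_le_of_lt ?_ hx
        rw [dist_eq_norm, dist_eq_norm]
        have : (q' t).1 - z₀.1 = (1 - t) • (z.1 - z₀.1) := by
          simp only [hq']
          module
        rw [this, norm_smul]
        refine mul_le_of_le_one_left (norm_nonneg _) ?_
        rw [Real.norm_eq_abs, abs_le]
        exact ⟨by linarith [ht.2], by linarith [ht.1]⟩
      · rw [hũe ⟨t, ht⟩] at hy
        exact hy
    have hũd : ∀ t, HasDerivAt ũ (IccExtend zero_le_one m t) t := fun t ↦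
      (hasDerivAt_integral_IccExtend m t).const_add _
    have hŨd : ∀ t, HasDerivAt Ũ (IccExtend zero_le_one k t) t := fun t ↦
      (hasDerivAt_integral_IccExtend k t).const_add _
    have hq'd : ∀ t, HasDerivAt q' (z₀.1 - z.1, IccExtend zero_le_one m t) t := by
      intro t
      refine HasDerivAt.prodMk ?_ (hũd t)
      have h1 := ((hasDerivAt_id t).smul_const z₀.1).add
        (((hasDerivAt_const t (1 : ℝ)).sub (hasDerivAt_id t)).smul_const z.1)
      convert! h1 using 1
      module
    set w : ℝ → Y := fun t ↦ Ũ t - (1 - t) • A (q' t) c with hw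
    have hwd : ∀ t, HasDerivAt w (IccExtend zero_le_one k t - ((1 - t) •
        (fderiv ℝ A (q' t) (z₀.1 - z.1, IccExtend zero_le_one m t) c) +
        (-1 : ℝ) • A (q' t) c)) t := by
      intro t
      have h1 : HasDerivAt (fun t ↦ A (q' t))
          (fderiv ℝ A (q' t) (z₀.1 - z.1, IccExtend zero_le_one m t)) t :=
        (hAd (q' t)).hasFDerivAt.comp_hasDerivAt t (hq'd t)
      have h2 : HasDerivAt (fun t ↦ A (q' t) c)
          (fderiv ℝ A (q' t) (z₀.1 - z.1, IccExtend zero_le_one m t) c) t := by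
        simpa using h1.clm_apply (hasDerivAt_const t c)
      have h3 : HasDerivAt (fun t : ℝ ↦ 1 - t) (-1) t := by
        exact (hasDerivAt_id' t).const_sub 1
      exact (hŨd t).sub (h3.smul h2)
    -- flatness turns the equation for `w` into a linear one
    have hlin : ∀ t ∈ Icc (0 : ℝ) 1, IccExtend zero_le_one k t - ((1 - t) •
        (fderiv ℝ A (q' t) (z₀.1 - z.1, IccExtend zero_le_one m t) c) + (-1 : ℝ) • A (q' t) c) =
        fderiv ℝ A (q' t) (0, w t) (z₀.1 - z.1) := by
      intro t ht
      have hkt : IccExtend zero_le_one k t = A (q' t) (-c) +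
          fderiv ℝ A (q' t) ((1 - t) • c, Ũ t) (z₀.1 - z.1) := by
        rw [IccExtend_of_mem _ _ ht, hk, pointwiseBilin_apply, rayCurveLinear_apply]
        simp only [ContinuousMap.comp_apply, ContinuousMap.coe_mk]
        rw [hqe, hŨe]
        exact hfd' _ _ _ _
      have hmt : IccExtend zero_le_one m t = A (q' t) (z₀.1 - z.1) := by
        rw [IccExtend_of_mem _ _ ht, hm]
        simp only [ContinuousMap.comp_apply, ContinuousMap.coe_mk]
        rw [hqe]
      rw [hkt, hmt, hflat (q' t) (hqball t ht)]
      have h1 : ((0 : X), w t) = ((1 - t) • c, Ũ t) - (1 - t) • (c, A (q' t) c) := by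
        ext
        · simp
        · simp [hw]
      rw [h1, (fderiv ℝ A (q' t)).map_sub, (fderiv ℝ A (q' t)).map_smul]
      simp only [sub_apply, smul_apply, map_neg]
      module
    have hq'c : Continuous q' := continuous_iff_continuousAt.2 fun t ↦ (hq'd t).continuousAt
    have hDA : Continuous (fderiv ℝ A) := hA.continuous_fderiv (by simp)
    obtain ⟨C, hC⟩ := exists_norm_le_of_continuous_clm (hDA.comp hq'c) 0 1
    have hw1 : w 1 = 0 := by
      refine eq_zero_of_abs_deriv_le_mul_abs_self_of_eq_zero_right
        (K := C * ‖z₀.1 - z.1‖) (a := 0) (b := 1)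
        (fun t _ ↦ (hwd t).continuousAt.continuousWithinAt)
        (fun t _ ↦ (hwd t).hasDerivWithinAt) ?_ ?_ 1 (by simp)
      · simp [hw, hŨ, hq', hũ]
      · intro t ht
        have ht' := Ico_subset_Icc_self ht
        rw [hlin t ht']
        refine ((fderiv ℝ A (q' t) (0, w t)).le_opNorm _).trans ?_
        have h1 : ‖fderiv ℝ A (q' t) (0, w t)‖ ≤ C * ‖w t‖ := by
          refine ((fderiv ℝ A (q' t)).le_opNorm _).trans ?_
          have : ‖((0 : X), w t)‖ = ‖w t‖ := by simp [Prod.norm_def]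
          rw [this]
          exact mul_le_mul_of_nonneg_right (hC t ht') (norm_nonneg _)
        calc _ ≤ C * ‖w t‖ * ‖z₀.1 - z.1‖ := mul_le_mul_of_nonneg_right h1 (norm_nonneg _)
          _ = _ := by ring
    rw [hŨe]
    simpa [hw] using hw1
  · intro b
    -- the transport along the constant segment is the identity
    have h1 : HasFDerivAt (fun y ↦ ev (ψ (z₀.1, y)))
        ((ev ∘L fderiv ℝ ψ z₀) ∘L ContinuousLinearMap.inr ℝ X Y) z₀.2 :=
      HasFDerivAt.comp (g := fun z ↦ ev (ψ z)) z₀.2 (hGd z₀ hz₀)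
        (hasFDerivAt_prodMk_right z₀.1 z₀.2)
    have h2 : (fun y ↦ ev (ψ (z₀.1, y))) =ᶠ[𝓝 z₀.2] id := by
      have : ∀ᶠ y in 𝓝 z₀.2, (z₀.1, y) ∈ O :=
        (Continuous.prodMk_right z₀.1).continuousAt (hO.mem_nhds hz₀)
      filter_upwards [this] with y hy
      have h3 : (⟨f, hf.continuous⟩ : C(X × X × Y, Y)).comp
          (rayCurve z₀.1 ((z₀.1, y), ψ (z₀.1, y))) = 0 := by
        ext t
        simp [rayCurve_apply, hf_def]
      rw [hψeq _ hy, h3]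
      simp [hev]
    have h3 := h1.unique ((hasFDerivAt_id z₀.2).congr_of_eventuallyEq h2)
    rw [(hGd z₀ hz₀).fderiv]
    exact congrArg (fun T ↦ T b) h3

/-- A smooth graph distribution `{(c, A z c)}` that is flat on an open set has near each point a
`Y`-valued first integral whose partial derivative along `Y` at that point is the identity. -/
theorem exists_firstIntegral {A : X × Y → X →L[ℝ] Y} {Ω : Set (X × Y)} (hΩ : IsOpen Ω)
    (hA : ContDiffOn ℝ ∞ A Ω)
    (hflat : ∀ z ∈ Ω, ∀ a b : X,
      fderiv ℝ A z (a, A z a) b = fderiv ℝ A z (b, A z b) a) {z₀ : X × Y} (hz₀ : z₀ ∈ Ω) :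
    ∃ (O : Set (X × Y)) (G : X × Y → Y), IsOpen O ∧ z₀ ∈ O ∧ O ⊆ Ω ∧ ContDiffOn ℝ ∞ G O ∧
      (∀ z ∈ O, ∀ c : X, fderiv ℝ G z (c, A z c) = 0) ∧
      ∀ b : Y, fderiv ℝ G z₀ (0, b) = b := by
  obtain ⟨R, hR, hRΩ⟩ := Metric.isOpen_iff.1 hΩ z₀ hz₀
  -- cut `A` off outside a small ball, to obtain a globally defined smooth map
  let χ : ContDiffBump z₀ := ⟨R / 4, R / 2, by positivity, by linarith⟩
  have hχ1 : ∀ z ∈ Metric.ball z₀ (R / 4), χ z = 1 := fun z hz ↦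
    χ.one_of_mem_closedBall (Metric.ball_subset_closedBall hz)
  have hB : ContDiff ℝ ∞ fun z ↦ χ z • A z := by
    rw [contDiff_iff_contDiffAt]
    intro z
    by_cases hz : z ∈ Metric.ball z₀ R
    · exact χ.contDiff.contDiffAt.smul (hA.contDiffAt (hΩ.mem_nhds (hRΩ hz)))
    · have : (fun z ↦ χ z • A z) =ᶠ[𝓝 z] fun _ ↦ 0 := by
        have hzo : z ∈ (Metric.closedBall z₀ (R / 2))ᶜ := by
          simp only [Metric.mem_ball, not_lt] at hz
          simp only [mem_compl_iff, Metric.mem_closedBall, not_le]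
          linarith
        filter_upwards [Metric.isClosed_closedBall.isOpen_compl.mem_nhds hzo] with y hy
        have : χ y = 0 := by
          apply χ.zero_of_le_dist
          simp only [mem_compl_iff, Metric.mem_closedBall, not_le] at hy
          exact hy.le
        simp [this]
      exact contDiffAt_const.congr_of_eventuallyEq this
  have heq : ∀ z ∈ Metric.ball z₀ (R / 4), (fun z ↦ χ z • A z) =ᶠ[𝓝 z] A := fun z hz ↦ by
    filter_upwards [Metric.isOpen_ball.mem_nhds hz] with y hy
    simp [hχ1 y hy]
  have hsub : Metric.ball z₀ (R / 4) ⊆ Ω :=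
    (Metric.ball_subset_ball (by linarith)).trans hRΩ
  obtain ⟨O, G, hO, hz, hG, h1, h2⟩ := exists_firstIntegral_of_contDiff hB (z₀ := z₀) (r := R / 4)
    (by positivity) fun z hz a b ↦ by
      rw [(heq z hz).fderiv_eq]
      simp only [hχ1 z hz, one_smul]
      exact hflat z (hsub hz) a b
  refine ⟨O ∩ Metric.ball z₀ (R / 4), G, hO.inter Metric.isOpen_ball,
    ⟨hz, Metric.mem_ball_self (by positivity)⟩, fun z hz ↦ hsub hz.2,
    hG.mono inter_subset_left, fun z hz c ↦ ?_, h2⟩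
  simpa [hχ1 z hz.2] using h1 z hz.1 c

end Frobenius

/-! ### Derivatives of vector-valued functions along vector fields -/

section VectorFields

variable {E : Type*} [NormedAddCommGroup E] [NormedSpace ℝ E]
  {M : Type*} [TopologicalSpace M] [ChartedSpace E M]
  {B : Type*} [NormedAddCommGroup B] [NormedSpace ℝ B]
  {V : Type*} [NormedAddCommGroup V] [NormedSpace ℝ V]

lemma mvfderiv_congr {f g : M → B} {q : M} (h : f =ᶠ[𝓝 q] g) :
    mvfderiv 𝓘(ℝ, E) f q = mvfderiv 𝓘(ℝ, E) g q := by
  ext v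
  exact congrArg (fun T : TangentSpace 𝓘(ℝ, E) q →L[ℝ] B ↦ T v) (h.mfderiv_eq (I := 𝓘(ℝ, E))
    (I' := 𝓘(ℝ, B)))

lemma mvfderiv_of_eventually_eq_zero {f : M → B} {q : M} (h : ∀ᶠ y in 𝓝 q, f y = 0) :
    mvfderiv 𝓘(ℝ, E) f q = 0 := by
  rw [mvfderiv_congr (g := fun _ ↦ 0) h, mvfderiv_const]

lemma mdifferentiableAt_fun_comp {g : V → B} {f : M → V} {q : M}
    (hg : DifferentiableAt ℝ g (f q)) (hf : MDifferentiableAt 𝓘(ℝ, E) 𝓘(ℝ, V) f q) :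
    MDifferentiableAt 𝓘(ℝ, E) 𝓘(ℝ, B) (fun y ↦ g (f y)) q :=
  hg.mdifferentiableAt.comp q hf

lemma mvfderiv_fun_comp {g : V → B} {f : M → V} {q : M} (hg : DifferentiableAt ℝ g (f q))
    (hf : MDifferentiableAt 𝓘(ℝ, E) 𝓘(ℝ, V) f q) (v : TangentSpace 𝓘(ℝ, E) q) :
    mvfderiv 𝓘(ℝ, E) (fun y ↦ g (f y)) q v = fderiv ℝ g (f q) (mvfderiv 𝓘(ℝ, E) f q v) := by
  have := mfderiv_comp_apply q hg.mdifferentiableAt hf v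
  rw [mfderiv_eq_fderiv] at this
  exact this

lemma mvfderiv_clm_comp (T : V →L[ℝ] B) {f : M → V} {q : M}
    (hf : MDifferentiableAt 𝓘(ℝ, E) 𝓘(ℝ, V) f q) (v : TangentSpace 𝓘(ℝ, E) q) :
    mvfderiv 𝓘(ℝ, E) (fun y ↦ T (f y)) q v = T (mvfderiv 𝓘(ℝ, E) f q v) := by
  rw [mvfderiv_fun_comp T.differentiableAt hf, T.fderiv]

lemma mdifferentiableAt_clm_apply {T : M → V →L[ℝ] B} {a : M → V} {q : M}
    (hT : MDifferentiableAt 𝓘(ℝ, E) 𝓘(ℝ, V →L[ℝ] B) T q)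
    (ha : MDifferentiableAt 𝓘(ℝ, E) 𝓘(ℝ, V) a q) :
    MDifferentiableAt 𝓘(ℝ, E) 𝓘(ℝ, B) (fun y ↦ T y (a y)) q := by
  have h := (differentiableAt_fst.clm_apply differentiableAt_snd :
    DifferentiableAt ℝ (fun p : (V →L[ℝ] B) × V ↦ p.1 p.2) (T q, a q))
  exact mdifferentiableAt_fun_comp (f := fun y ↦ (T y, a y)) h (hT.prodMk_space ha)

lemma mvfderiv_clm_apply {T : M → V →L[ℝ] B} {a : M → V} {q : M}
    (hT : MDifferentiableAt 𝓘(ℝ, E) 𝓘(ℝ, V →L[ℝ] B) T q)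
    (ha : MDifferentiableAt 𝓘(ℝ, E) 𝓘(ℝ, V) a q) (v : TangentSpace 𝓘(ℝ, E) q) :
    mvfderiv 𝓘(ℝ, E) (fun y ↦ T y (a y)) q v =
      mvfderiv 𝓘(ℝ, E) T q v (a q) + T q (mvfderiv 𝓘(ℝ, E) a q v) := by
  have h : HasFDerivAt (fun p : (V →L[ℝ] B) × V ↦ p.1 p.2) _ (T q, a q) :=
    hasFDerivAt_fst.clm_apply hasFDerivAt_snd
  have hf := hT.prodMk_space ha
  have key := mvfderiv_fun_comp (g := fun p : (V →L[ℝ] B) × V ↦ p.1 p.2) (f := fun y ↦ (T y, a y))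
    h.differentiableAt hf v
  have h1 := mvfderiv_clm_comp (.fst ℝ (V →L[ℝ] B) V) hf v
  have h2 := mvfderiv_clm_comp (.snd ℝ (V →L[ℝ] B) V) hf v
  simp only [ContinuousLinearMap.coe_fst', ContinuousLinearMap.coe_snd'] at h1 h2
  rw [key, h.fderiv, h1, h2]
  simp [add_comm]

variable [IsManifold 𝓘(ℝ, E) ∞ M]

/-- The representation of a vector field in the chart at `x`. -/
def chartRep (x : M) (X : VecField E M) : E → E :=
  VectorField.mpullbackWithin 𝓘(ℝ, E) 𝓘(ℝ, E) (extChartAt 𝓘(ℝ, E) x).symm X (range 𝓘(ℝ, E))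

lemma mfderiv_extChartAt_apply [CompleteSpace E] (x : M) (X : VecField E M) :
    ∀ᶠ q in 𝓝 x, mfderiv 𝓘(ℝ, E) 𝓘(ℝ, E) (extChartAt 𝓘(ℝ, E) x) q (X q) =
      chartRep x X (extChartAt 𝓘(ℝ, E) x q) := by
  have : IsManifold 𝓘(ℝ, E) 1 M := .of_le (n := ∞) (by simp)
  have h1 := VectorField.eventuallyEq_mpullback_mpullbackWithin_extChartAt (I := 𝓘(ℝ, E))
    (s := univ) (x := x) X
  rw [nhdsWithin_univ] at h1
  filter_upwards [h1, extChartAt_source_mem_nhds (I := 𝓘(ℝ, E)) x] with q hq hqs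
  rw [hq, VectorField.mpullback_apply]
  exact (isInvertible_mfderiv_extChartAt hqs).self_apply_inverse _

lemma differentiableAt_chartRep [CompleteSpace E] {x : M} {X : VecField E M}
    (hX : MDiffAt (T% X) x) : DifferentiableAt ℝ (chartRep x X) (extChartAt 𝓘(ℝ, E) x x) := by
  have : IsManifold 𝓘(ℝ, E) 2 M := .of_le (n := ∞) (by norm_cast)
  have := MDifferentiableWithinAt.differentiableWithinAt_mpullbackWithin_vectorField
    (I := 𝓘(ℝ, E)) (s := univ) (mdifferentiableWithinAt_univ.2 hX)
  rw [← differentiableWithinAt_univ]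
  simpa [chartRep] using this

/-- In the chart at `x`, the derivative of `h` along a vector field is the derivative of the
coordinate expression of `h` along that of the field. -/
lemma exists_mvfderiv_eventuallyEq_fderiv [CompleteSpace E] {h : M → B} {x : M}
    (hh : ContMDiffAt 𝓘(ℝ, E) 𝓘(ℝ, B) ∞ h x) :
    ∃ ĥ : E → B, ContDiffAt ℝ 2 ĥ (extChartAt 𝓘(ℝ, E) x x) ∧ ∀ V : VecField E M,
      ∀ᶠ q in 𝓝 x, mvfderiv 𝓘(ℝ, E) h q (V q) =
        fderiv ℝ ĥ (extChartAt 𝓘(ℝ, E) x q) (chartRep x V (extChartAt 𝓘(ℝ, E) x q)) := by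
  set κ := extChartAt 𝓘(ℝ, E) x with hκ
  set ĥ : E → B := h ∘ κ.symm with hĥ
  have hĥs : ContDiffAt ℝ 2 ĥ (κ x) := by
    have h2 := ((contMDiffAt_iff (I := 𝓘(ℝ, E)) (I' := 𝓘(ℝ, B))).1 hh).2
    simp only [modelWithCornersSelf_coe, range_id, contDiffWithinAt_univ] at h2
    exact h2.of_le (by norm_cast)
  refine ⟨ĥ, hĥs, fun V ↦ ?_⟩
  have hĥd : ∀ᶠ y in 𝓝 (κ x), DifferentiableAt ℝ ĥ y := by
    filter_upwards [hĥs.eventually (by simp)] with y hy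
    exact hy.differentiableAt (by simp)
  have hκc : Tendsto κ (𝓝 x) (𝓝 (κ x)) := continuousAt_extChartAt x
  filter_upwards [hκc.eventually hĥd, mfderiv_extChartAt_apply x V,
    extChartAt_source_mem_nhds (I := 𝓘(ℝ, E)) x] with q h2 h3 h4
  have hnear : h =ᶠ[𝓝 q] fun y ↦ ĥ (κ y) := by
    filter_upwards [(isOpen_extChartAt_source x).mem_nhds h4] with y hy
    exact congrArg h ((extChartAt 𝓘(ℝ, E) x).left_inv hy).symm
  have : IsManifold 𝓘(ℝ, E) 1 M := .of_le (n := ∞) (by simp)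
  rw [← h3, mvfderiv_congr hnear, mvfderiv_fun_comp h2
    (mdifferentiableAt_extChartAt (by rwa [extChartAt_source] at h4))]
  rfl

lemma mvfderiv_extChartAt_self [CompleteSpace E] (x : M) (X : VecField E M) :
    mvfderiv 𝓘(ℝ, E) (extChartAt 𝓘(ℝ, E) x) x (X x) = chartRep x X (extChartAt 𝓘(ℝ, E) x x) :=
  (mfderiv_extChartAt_apply x X).self_of_nhds

lemma mdifferentiableAt_extChartAt_self (x : M) :
    MDifferentiableAt 𝓘(ℝ, E) 𝓘(ℝ, E) (extChartAt 𝓘(ℝ, E) x) x :=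
  have : IsManifold 𝓘(ℝ, E) 1 M := .of_le (n := ∞) (by simp)
  mdifferentiableAt_extChartAt (mem_chart_source E x)

lemma mdifferentiableAt_mvfderiv_apply [CompleteSpace E] {h : M → B} {x : M} {X : VecField E M}
    (hh : ContMDiffAt 𝓘(ℝ, E) 𝓘(ℝ, B) ∞ h x) (hX : MDiffAt (T% X) x) :
    MDifferentiableAt 𝓘(ℝ, E) 𝓘(ℝ, B) (fun q ↦ mvfderiv 𝓘(ℝ, E) h q (X q)) x := by
  obtain ⟨ĥ, hĥ, key⟩ := exists_mvfderiv_eventuallyEq_fderiv hh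
  have hd : DifferentiableAt ℝ (fun y ↦ fderiv ℝ ĥ y (chartRep x X y)) (extChartAt 𝓘(ℝ, E) x x) :=
    ((hĥ.fderiv_right (m := 1) (by norm_num)).differentiableAt (by simp)).clm_apply
      (differentiableAt_chartRep hX)
  exact (hd.mdifferentiableAt.comp x (mdifferentiableAt_extChartAt_self x)).congr_of_eventuallyEq
    (key X)

/-- The Lie bracket as a commutator of derivations, for functions with values in a normed space. -/
lemma mvfderiv_bracket [CompleteSpace E]
    {h : M → B} {x : M} {X Z : VecField E M} (hh : ContMDiffAt 𝓘(ℝ, E) 𝓘(ℝ, B) ∞ h x)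
    (hX : MDiffAt (T% X) x) (hZ : MDiffAt (T% Z) x) :
    mvfderiv 𝓘(ℝ, E) h x (bracket X Z x) =
      mvfderiv 𝓘(ℝ, E) (fun q ↦ mvfderiv 𝓘(ℝ, E) h q (Z q)) x (X x) -
      mvfderiv 𝓘(ℝ, E) (fun q ↦ mvfderiv 𝓘(ℝ, E) h q (X q)) x (Z x) := by
  obtain ⟨ĥ, hĥ, key⟩ := exists_mvfderiv_eventuallyEq_fderiv hh
  have hd1 : DifferentiableAt ℝ (fderiv ℝ ĥ) (extChartAt 𝓘(ℝ, E) x x) :=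
    (hĥ.fderiv_right (m := 1) (by norm_num)).differentiableAt (by simp)
  have key2 : ∀ V W : VecField E M, MDiffAt (T% V) x →
      mvfderiv 𝓘(ℝ, E) (fun q ↦ mvfderiv 𝓘(ℝ, E) h q (V q)) x (W x) =
      fderiv ℝ (fderiv ℝ ĥ) (extChartAt 𝓘(ℝ, E) x x) (chartRep x W (extChartAt 𝓘(ℝ, E) x x))
          (chartRep x V (extChartAt 𝓘(ℝ, E) x x)) +
        fderiv ℝ ĥ (extChartAt 𝓘(ℝ, E) x x) (fderiv ℝ (chartRep x V) (extChartAt 𝓘(ℝ, E) x x)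
          (chartRep x W (extChartAt 𝓘(ℝ, E) x x))) := by
    intro V W hV
    have hd2 := differentiableAt_chartRep hV
    rw [mvfderiv_congr (key V), mvfderiv_fun_comp (g := fun y ↦ fderiv ℝ ĥ y (chartRep x V y))
      (hd1.clm_apply hd2) (mdifferentiableAt_extChartAt_self x), mvfderiv_extChartAt_self,
      fderiv_clm_apply hd1 hd2]
    simp [add_comm]
  have hsymm : IsSymmSndFDerivAt ℝ ĥ (extChartAt 𝓘(ℝ, E) x x) := hĥ.isSymmSndFDerivAt (by simp)
  rw [key2 Z X hZ, key2 X Z hX, hsymm.eq, (key (bracket X Z)).self_of_nhds]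
  have hb : chartRep x (bracket X Z) (extChartAt 𝓘(ℝ, E) x x) =
      VectorField.lieBracket ℝ (chartRep x X) (chartRep x Z) (extChartAt 𝓘(ℝ, E) x x) := by
    have h0 : VectorField.lieBracket ℝ (chartRep x X) (chartRep x Z) =
        VectorField.lieBracketWithin ℝ (chartRep x X) (chartRep x Z)
          ((extChartAt 𝓘(ℝ, E) x).symm ⁻¹' univ ∩ range 𝓘(ℝ, E)) := by
      rw [preimage_univ, univ_inter, modelWithCornersSelf_coe, range_id,
        VectorField.lieBracketWithin_univ]
    have h1 : bracket X Z x = (mfderiv 𝓘(ℝ, E) 𝓘(ℝ, E) (extChartAt 𝓘(ℝ, E) x) x).inverse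
        ((VectorField.lieBracket ℝ (chartRep x X) (chartRep x Z)
          (extChartAt 𝓘(ℝ, E) x x) : E)) := by
      rw [h0]
      exact VectorField.mlieBracketWithin_apply
    have : IsManifold 𝓘(ℝ, E) 1 M := .of_le (n := ∞) (by simp)
    rw [← mvfderiv_extChartAt_self, h1]
    exact (isInvertible_mfderiv_extChartAt (mem_extChartAt_source x)).self_apply_inverse _
  rw [hb, VectorField.lieBracket, map_sub]
  abel

end VectorFields

/-! ### The Levi-Civita connection -/

section Connection

variable {E : Type*} [NormedAddCommGroup E] [NormedSpace ℝ E]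
  {M : Type*} [TopologicalSpace M] [ChartedSpace E M]

lemma lieDer_congr {f g : M → ℝ} {x : M} (h : f =ᶠ[𝓝 x] g) (X : VecField E M) :
    lieDer X f x = lieDer X g x := by
  rw [lieDer, lieDer, mvfderiv_congr h]

lemma lieDer_of_eventually_eq_const {f : M → ℝ} {x : M} {c : ℝ} (h : ∀ᶠ y in 𝓝 x, f y = c)
    (X : VecField E M) : lieDer X f x = 0 := by
  rw [lieDer_congr (g := fun _ ↦ c) h, lieDer, mvfderiv_const]
  simp

lemma lieDer_mul {f g : M → ℝ} {x : M} (hf : MDifferentiableAt 𝓘(ℝ, E) 𝓘(ℝ, ℝ) f x)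
    (hg : MDifferentiableAt 𝓘(ℝ, E) 𝓘(ℝ, ℝ) g x) (X : VecField E M) :
    lieDer X (fun y ↦ f y * g y) x = f x * lieDer X g x + g x * lieDer X f x := by
  rw [lieDer, mvfderiv_fun_mul hf hg]
  simp [lieDer]

lemma lieDer_add {f g : M → ℝ} {x : M} (hf : MDifferentiableAt 𝓘(ℝ, E) 𝓘(ℝ, ℝ) f x)
    (hg : MDifferentiableAt 𝓘(ℝ, E) 𝓘(ℝ, ℝ) g x) (X : VecField E M) :
    lieDer X (fun y ↦ f y + g y) x = lieDer X f x + lieDer X g x := by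
  rw [lieDer, mvfderiv_fun_add hf hg]
  simp [lieDer]

lemma bracket_swap (X Y : VecField E M) (x : M) : bracket X Y x = -bracket Y X x :=
  VectorField.mlieBracket_swap_apply

lemma lieDer_const (X : VecField E M) (c : ℝ) (x : M) : lieDer X (fun _ ↦ c) x = 0 :=
  lieDer_of_eventually_eq_const (.of_forall fun _ ↦ rfl) X

variable [Bundle.RiemannianBundle (fun x : M ↦ TangentSpace 𝓘(ℝ, E) x)]

lemma metricFun_comm (X Y : VecField E M) : metricFun X Y = metricFun Y X :=
  funext fun _ ↦ real_inner_comm _ _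

variable [IsManifold 𝓘(ℝ, E) ∞ M]
  [IsContMDiffRiemannianBundle 𝓘(ℝ, E) ∞ E (fun x : M ↦ TangentSpace 𝓘(ℝ, E) x)]

lemma mdifferentiableAt_metricFun {X Y : VecField E M} {x : M} (hX : MDiffAt (T% X) x)
    (hY : MDiffAt (T% Y) x) : MDifferentiableAt 𝓘(ℝ, E) 𝓘(ℝ, ℝ) (metricFun X Y) x :=
  MDifferentiableAt.inner_bundle hX hY

variable [FiniteDimensional ℝ E]

/-- The Koszul expression is tensorial in its last argument. -/
lemma tensorialAt_koszul {X Y : VecField E M} {x : M} (hX : MDiffAt (T% X) x)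
    (hY : MDiffAt (T% Y) x) :
    TensorialAt 𝓘(ℝ, E) E (fun Z : VecField E M ↦ koszul X Y Z x) x where
  smul {f Z} hf hZ := by
    have h1 : ∀ W : VecField E M, metricFun W (f • Z) = fun y ↦ f y * metricFun W Z y := by
      intro W
      ext y
      simp [metricFun, inner_smul_right]
    have h2 : ∀ W : VecField E M, bracket W (f • Z) x =
        lieDer W f x • Z x + f x • bracket W Z x := fun W ↦
      VectorField.mlieBracket_smul_right hf hZ
    have h3 : ∀ g : M → ℝ, lieDer (f • Z) g x = f x * lieDer Z g x := by
      intro g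
      simp [lieDer]
    simp only [koszul, h1, h2, h3, lieDer_mul hf (mdifferentiableAt_metricFun hY hZ),
      lieDer_mul hf (mdifferentiableAt_metricFun hX hZ), Pi.smul_apply', inner_add_left,
      inner_smul_left, inner_smul_right, smul_eq_mul]
    simp only [metricFun, real_inner_comm (Z x), conj_trivial]
    ring
  add {Z Z'} hZ hZ' := by
    have h1 : ∀ W : VecField E M, metricFun W (Z + Z') =
        fun y ↦ metricFun W Z y + metricFun W Z' y := by
      intro W
      ext y
      simp [metricFun, inner_add_right]
    have h2 : ∀ W : VecField E M, bracket W (Z + Z') x = bracket W Z x + bracket W Z' x :=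
      fun W ↦ VectorField.mlieBracket_add_right hZ hZ'
    have h3 : ∀ g : M → ℝ, lieDer (Z + Z') g x = lieDer Z g x + lieDer Z' g x := by
      intro g
      simp [lieDer]
    simp only [koszul, h1, h2, h3, lieDer_add (mdifferentiableAt_metricFun hY hZ)
      (mdifferentiableAt_metricFun hY hZ'), lieDer_add (mdifferentiableAt_metricFun hX hZ)
      (mdifferentiableAt_metricFun hX hZ'), Pi.add_apply, inner_add_left, inner_add_right]
    ring

/-- The Levi-Civita connection is characterised by the Koszul formula. -/
lemma inner_leviCivita {X Y Z : VecField E M} {x : M} (hX : MDiffAt (T% X) x)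
    (hY : MDiffAt (T% Y) x) (hZ : MDiffAt (T% Z) x) :
    inner ℝ (leviCivita X Y x) (Z x) = koszul X Y Z x := by
  have hT := tensorialAt_koszul hX hY
  set L := TensorialAt.mkHom (I := 𝓘(ℝ, E)) (F := E) (fun Z : VecField E M ↦ koszul X Y Z x) x hT
    with hL
  have hLi : ∀ v : TangentSpace 𝓘(ℝ, E) x, koszul X Y (FiberBundle.extend E v) x = L v := fun v ↦
    (TensorialAt.mkHom_apply_eq_extend hT v).symm
  rw [← TensorialAt.mkHom_apply hT hZ, ← hL, leviCivita, sum_inner]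
  conv_rhs => rw [← (stdOrthonormalBasis ℝ (TangentSpace 𝓘(ℝ, E) x)).sum_repr (Z x)]
  rw [map_sum]
  refine Finset.sum_congr rfl fun i _ ↦ ?_
  rw [hLi, map_smul, inner_smul_left, (stdOrthonormalBasis ℝ _).repr_apply_apply]
  simp [mul_comm]

end Connection

/-! ### O'Neill's tensors -/

section ONeill

variable {E : Type*} [NormedAddCommGroup E] [NormedSpace ℝ E]
  {M : Type*} [TopologicalSpace M] [ChartedSpace E M]
  {E' : Type*} [NormedAddCommGroup E'] [NormedSpace ℝ E']
  {N : Type*} [TopologicalSpace N] [ChartedSpace E' N]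

section

variable [IsManifold 𝓘(ℝ, E) ∞ M]

lemma IsSmoothVecField.mdifferentiableAt {X : VecField E M} (hX : IsSmoothVecField X) (x : M) :
    MDiffAt (T% X) x :=
  (hX x).mdifferentiableAt (by simp)

lemma IsSmoothVecField.neg {X : VecField E M} (hX : IsSmoothVecField X) :
    IsSmoothVecField (-X) :=
  ContMDiff.neg_section hX

lemma IsSmoothEndoField.app {φ : EndoField E M} (hφ : IsSmoothEndoField φ) {X : VecField E M}
    (hX : IsSmoothVecField X) : IsSmoothVecField (φ.app X) :=
  ContMDiff.clm_bundle_apply hφ hX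

end

variable [Bundle.RiemannianBundle (fun x : M ↦ TangentSpace 𝓘(ℝ, E) x)]

lemma inner_eq_zero_of_horizontal {F : M → N} {x : M} {v w : TangentSpace 𝓘(ℝ, E) x}
    (hv : v ∈ horizontal (E' := E') F x) (hw : w ∈ vertical (E' := E') F x) :
    inner ℝ v w = (0 : ℝ) :=
  Submodule.inner_left_of_mem_orthogonal hw hv

lemma inner_eq_zero_of_vertical {F : M → N} {x : M} {v w : TangentSpace 𝓘(ℝ, E) x}
    (hv : v ∈ vertical (E' := E') F x) (hw : w ∈ horizontal (E' := E') F x) :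
    inner ℝ v w = (0 : ℝ) :=
  Submodule.inner_right_of_mem_orthogonal hv hw

lemma metricFun_hor_vert {F : M → N} {X W : VecField E M}
    (hX : ∀ x, X x ∈ horizontal (E' := E') F x) (hW : ∀ x, W x ∈ vertical (E' := E') F x) :
    metricFun X W = fun _ ↦ 0 :=
  funext fun x ↦ inner_eq_zero_of_horizontal (hX x) (hW x)

lemma metricFun_vert_hor {F : M → N} {W X : VecField E M}
    (hW : ∀ x, W x ∈ vertical (E' := E') F x) (hX : ∀ x, X x ∈ horizontal (E' := E') F x) :
    metricFun W X = fun _ ↦ 0 :=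
  funext fun x ↦ inner_eq_zero_of_vertical (hW x) (hX x)

/-- If `g (∇_X W, Z)` and `g (∇_Z W, X)` vanish for `X`, `Z` horizontal and `W` vertical, then so
does `g ([X, Z], W)`. -/
lemma inner_bracket_eq_zero {F : M → N} {X Z W : VecField E M}
    (hX : ∀ x, X x ∈ horizontal (E' := E') F x) (hZ : ∀ x, Z x ∈ horizontal (E' := E') F x)
    (hW : ∀ x, W x ∈ vertical (E' := E') F x) {x : M}
    (h₁ : koszul X W Z x = 0) (h₂ : koszul Z W X x = 0) :
    inner ℝ (bracket X Z x) (W x) = (0 : ℝ) := by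
  simp only [koszul, metricFun_hor_vert hX hW, metricFun_hor_vert hZ hW, metricFun_vert_hor hW hX,
    metricFun_vert_hor hW hZ, lieDer_const, bracket_swap Z X, bracket_swap W X,
    bracket_swap W Z, inner_neg_left] at h₁ h₂
  rw [metricFun_comm Z X] at h₂
  linarith

/-- `g (∇_V Z, U) = - g (∇_V U, Z)` for `V` and `U` vertical and `Z` horizontal. -/
lemma koszul_vert_hor {F : M → N} {V Z U : VecField E M}
    (hZ : ∀ x, Z x ∈ horizontal (E' := E') F x)
    (hU : ∀ x, U x ∈ vertical (E' := E') F x) (x : M) :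
    koszul V Z U x = -koszul V U Z x := by
  simp only [koszul, metricFun_hor_vert hZ hU, metricFun_vert_hor hU hZ,
    lieDer_const, bracket_swap Z U, inner_neg_left]
  ring

variable [FiniteDimensional ℝ E]

lemma vertPart_of_vertical {F : M → N} {X : VecField E M}
    (hX : ∀ x, X x ∈ vertical (E' := E') F x) : vertPart E' F X = X :=
  funext fun x ↦ Submodule.starProjection_eq_self_iff.2 (hX x)

lemma vertPart_of_horizontal {F : M → N} {X : VecField E M}
    (hX : ∀ x, X x ∈ horizontal (E' := E') F x) : vertPart E' F X = 0 :=
  funext fun x ↦ (Submodule.starProjection_apply_eq_zero_iff _).2 (hX x)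

lemma horPart_of_horizontal {F : M → N} {X : VecField E M}
    (hX : ∀ x, X x ∈ horizontal (E' := E') F x) : horPart E' F X = X :=
  funext fun x ↦ Submodule.starProjection_eq_self_iff.2 (hX x)

lemma horPart_of_vertical {F : M → N} {X : VecField E M}
    (hX : ∀ x, X x ∈ vertical (E' := E') F x) : horPart E' F X = 0 :=
  funext fun x ↦ (Submodule.starProjection_apply_eq_zero_iff _).2
    (Submodule.le_orthogonal_orthogonal _ (hX x))

variable [IsManifold 𝓘(ℝ, E) ∞ M]

lemma leviCivita_zero_right (X : VecField E M) : leviCivita X 0 = 0 := by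
  have h0 : ∀ W : VecField E M, metricFun W 0 = fun _ ↦ 0 := fun W ↦
    funext fun y ↦ inner_zero_right _
  have h1 : ∀ W : VecField E M, metricFun 0 W = fun _ ↦ 0 := fun W ↦
    funext fun y ↦ inner_zero_left _
  have h2 : ∀ W : VecField E M, bracket W 0 = 0 := fun W ↦ VectorField.mlieBracket_zero_right
  have h3 : ∀ W : VecField E M, bracket 0 W = 0 := fun W ↦ VectorField.mlieBracket_zero_left
  funext x
  refine Finset.sum_eq_zero fun i _ ↦ ?_
  simp only [koszul, h0, h1, h2, h3, lieDer_const, Pi.zero_apply, inner_zero_left,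
    inner_zero_right]
  simp [lieDer]

/-- `𝒜_X W = ℋ ∇_X W` for `X` horizontal and `W` vertical. -/
lemma oneillA_eq_zero_iff {F : M → N} {X W : VecField E M}
    (hX : ∀ x, X x ∈ horizontal (E' := E') F x) (hW : ∀ x, W x ∈ vertical (E' := E') F x) (x : M) :
    oneillA E' F X W x = 0 ↔
      ∀ z ∈ horizontal (E' := E') F x, inner ℝ (leviCivita X W x) z = (0 : ℝ) := by
  rw [oneillA, horPart_of_horizontal hX, horPart_of_vertical hW, vertPart_of_vertical hW,
    leviCivita_zero_right, vertPart_of_vertical (X := 0) (fun _ ↦ Submodule.zero_mem _), zero_add]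
  exact (Submodule.starProjection_apply_eq_zero_iff _).trans (Submodule.mem_orthogonal' _ _)

/-- `𝒯_V Z = 𝒱 ∇_V Z` for `V` vertical and `Z` horizontal. -/
lemma oneillT_eq_zero_iff {F : M → N} {V Z : VecField E M}
    (hV : ∀ x, V x ∈ vertical (E' := E') F x) (hZ : ∀ x, Z x ∈ horizontal (E' := E') F x) (x : M) :
    oneillT E' F V Z x = 0 ↔
      ∀ u ∈ vertical (E' := E') F x, inner ℝ (leviCivita V Z x) u = (0 : ℝ) := by
  rw [oneillT, vertPart_of_vertical hV, horPart_of_horizontal hZ, vertPart_of_horizontal hZ,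
    leviCivita_zero_right, horPart_of_horizontal (X := 0) (fun _ ↦ Submodule.zero_mem _), zero_add]
  exact (Submodule.starProjection_apply_eq_zero_iff _).trans (Submodule.mem_orthogonal' _ _)

end ONeill

/-! ### The cosymplectic structure -/

section Cosymplectic

variable {E : Type*} [NormedAddCommGroup E] [NormedSpace ℝ E]
  {M : Type*} [TopologicalSpace M] [ChartedSpace E M] [IsManifold 𝓘(ℝ, E) ∞ M]
  [Bundle.RiemannianBundle (fun x : M ↦ TangentSpace 𝓘(ℝ, E) x)]
  {E' : Type*} [NormedAddCommGroup E'] [NormedSpace ℝ E']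
  {N : Type*} [TopologicalSpace N] [ChartedSpace E' N]
  {φ : EndoField E M} {ξ : VecField E M} {η : OneForm E M} {F : M → N}

/-- The hypotheses on the fibres in the form in which they are used: `φ` exchanges the vertical and
the horizontal distribution, and the Reeb field is horizontal. -/
structure ExchangesFibres (E' : Type*) [NormedAddCommGroup E'] [NormedSpace ℝ E']
    {N : Type*} [TopologicalSpace N] [ChartedSpace E' N]
    (φ : EndoField E M) (ξ : VecField E M) (F : M → N) : Prop where
  map_vertical : ∀ (x : M), ∀ v ∈ vertical (E' := E') F x, φ x v ∈ horizontal (E' := E') F x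
  map_horizontal : ∀ (x : M), ∀ v ∈ horizontal (E' := E') F x, φ x v ∈ vertical (E' := E') F x
  xi_horizontal : ∀ x : M, ξ x ∈ horizontal (E' := E') F x

lemma IsAlmostContactMetric.eta_vertical (hM : IsAlmostContactMetric φ ξ η)
    (hξ : ∀ x : M, ξ x ∈ horizontal (E' := E') F x) {x : M} {v : TangentSpace 𝓘(ℝ, E) x}
    (hv : v ∈ vertical (E' := E') F x) : η x v = 0 := by
  rw [hM.eta_eq]
  exact inner_eq_zero_of_vertical hv (hξ x)

/-- `φ` maps `φ (ker F_*) ⊕ ⟨ξ⟩` to `ker F_*`, as `φ² = -1` on `ker F_*` and `φ ξ = 0`. -/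
lemma IsAlmostContactMetric.exchangesFibres (hM : IsAlmostContactMetric φ ξ η)
    (hanti : IsAntiInvariant (E' := E') φ F)
    (hsplit : ∀ x : M, horizontal (E' := E') F x =
        (vertical (E' := E') F x).map (φ x).toLinearMap ⊔ Submodule.span ℝ {ξ x}) :
    ExchangesFibres E' φ ξ F := by
  have hξ : ∀ x : M, ξ x ∈ horizontal (E' := E') F x := fun x ↦ by
    rw [hsplit x]
    exact Submodule.mem_sup_right (Submodule.mem_span_singleton_self _)
  refine ⟨hanti, fun x v hv ↦ ?_, hξ⟩
  rw [hsplit x, Submodule.mem_sup] at hv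
  obtain ⟨_, ⟨w, hw, rfl⟩, b, hb, rfl⟩ := hv
  obtain ⟨c, rfl⟩ := Submodule.mem_span_singleton.1 hb
  have : φ x ((φ x).toLinearMap w + c • ξ x) = -w := by
    change φ x (φ x w + c • ξ x) = -w
    rw [map_add, map_smul, hM.phi_xi, hM.phi_phi, hM.eta_vertical hξ hw]
    simp
  rw [this]
  exact Submodule.neg_mem _ hw

variable [IsContMDiffRiemannianBundle 𝓘(ℝ, E) ∞ E (fun x : M ↦ TangentSpace 𝓘(ℝ, E) x)]

/-- `g (∇_V U, ξ) = 0` for vertical `V` and `U`. Closedness of `Φ` on `(ξ, V, φ U)` together with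
the normality condition on `(U, ξ)` gives `(L_ξ g) (V, U) = 0`, and `η [V, U] = 0` because `η` is
closed. -/
lemma IsCosymplectic.koszul_xi (hM : IsCosymplectic φ ξ η) (hφ : ExchangesFibres E' φ ξ F)
    {V U : VecField E M} (hV : IsSmoothSectionOf (vertical (E' := E') F) V)
    (hU : IsSmoothSectionOf (vertical (E' := E') F) U) (x : M) : koszul V U ξ x = 0 := by
  have hη : ∀ {W : VecField E M}, IsSmoothSectionOf (vertical (E' := E') F) W →
      ∀ y, η y (W y) = 0 := fun hW y ↦ hM.eta_vertical hφ.xi_horizontal (hW.2 y)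
  have hΦ := hM.fundamentalForm_closed ξ V (φ.app U) hM.smooth_xi hV.1
    (hM.smooth_phi.app hU.1) x
  have hN := hM.normal U ξ hU.1 hM.smooth_xi x
  have hdη := hM.eta_closed V U hV.1 hU.1 x
  rw [hM.eta_closed U ξ hU.1 hM.smooth_xi x, zero_smul, add_zero] at hN
  simp only [dOne, hη hV, hη hU, lieDer_const] at hdη
  have hφξ : φ.app ξ = 0 := funext fun y ↦ hM.phi_xi y
  have hb : ∀ W : VecField E M, bracket W 0 = 0 := fun W ↦ VectorField.mlieBracket_zero_right
  simp only [nijenhuis, hφξ, hb, Pi.zero_apply, map_zero] at hN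
  have hφφU : ∀ y, φ y (φ y (U y)) = -U y := fun y ↦ by rw [hM.phi_phi, hη hU y]; simp
  have h1 : (fun y ↦ fundamentalForm φ y (V y) (φ.app U y)) = fun y ↦ -1 * metricFun V U y :=
    funext fun y ↦ by simp [fundamentalForm, EndoField.app, hφφU, metricFun]
  have h2 : (fun y ↦ fundamentalForm φ y (φ.app U y) (ξ y)) = fun _ ↦ 0 :=
    funext fun y ↦ by simp [fundamentalForm, hM.phi_xi]
  have h3 : (fun y ↦ fundamentalForm φ y (ξ y) (V y)) = fun _ ↦ 0 :=
    funext fun y ↦ by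
      rw [fundamentalForm, real_inner_comm, ← hM.eta_eq, hM.eta_phi]
  have h4 : inner ℝ (bracket (φ.app U) ξ x) (φ x (V x)) =
      inner ℝ (bracket U ξ x) (V x) := by
    have h5 := hM.inner_phi_phi x (bracket (φ.app U) ξ x) (φ x (V x))
    rw [hM.eta_phi, mul_zero, sub_zero, hM.phi_phi x (V x), hη hV x, zero_smul, add_zero,
      inner_neg_right] at h5
    have h6 : φ x (bracket (φ.app U) ξ x) = φ x (φ x (bracket U ξ x)) := by
      rw [add_zero, sub_zero] at hN
      exact (sub_eq_zero.1 hN).symm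
    rw [← h5, h6, hM.phi_phi, inner_add_left, inner_smul_left, real_inner_comm (V x) (ξ x),
      ← hM.eta_eq, hη hV x]
    simp
  simp only [dTwo, h1, h2, h3, lieDer_const] at hΦ
  have h7 : lieDer ξ (fun y ↦ -1 * metricFun V U y) x = -lieDer ξ (metricFun V U) x := by
    rw [lieDer_mul mdifferentiableAt_const (mdifferentiableAt_metricFun
      (hV.1.mdifferentiableAt x) (hU.1.mdifferentiableAt x)), lieDer_const]
    ring
  simp only [h7, fundamentalForm, EndoField.app, hM.phi_xi, inner_zero_right, hφφU,
    inner_neg_right] at hΦ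
  have h8 : inner ℝ (bracket V U x) (ξ x) = (0 : ℝ) := by
    rw [← hM.eta_eq]
    linarith
  rw [h4, bracket_swap ξ V, inner_neg_left] at hΦ
  simp only [koszul, metricFun_vert_hor hU.2 hφ.xi_horizontal,
    metricFun_vert_hor hV.2 hφ.xi_horizontal, lieDer_const, h8]
  linarith

variable [FiniteDimensional ℝ E]

/-- The horizontal distribution is involutive if `𝒜_X (φ Y) = 0` for horizontal `X` and `Y`, as
every vertical field is of the form `φ Y`. -/
lemma IsAlmostContactMetric.inner_bracket_eq_zero (hM : IsAlmostContactMetric φ ξ η)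
    (hφ : ExchangesFibres E' φ ξ F)
    (hA : ∀ X Y : VecField E M,
        IsSmoothSectionOf (horizontal (E' := E') F) X →
        IsSmoothSectionOf (horizontal (E' := E') F) Y →
        ∀ x : M, oneillA E' F X (φ.app Y) x = 0)
    {X Z W : VecField E M} (hX : IsSmoothSectionOf (horizontal (E' := E') F) X)
    (hZ : IsSmoothSectionOf (horizontal (E' := E') F) Z)
    (hW : IsSmoothSectionOf (vertical (E' := E') F) W) (x : M) :
    inner ℝ (bracket X Z x) (W x) = (0 : ℝ) := by
  have hY : IsSmoothSectionOf (horizontal (E' := E') F) (-(φ.app W)) :=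
    ⟨(hM.smooth_phi.app hW.1).neg, fun y ↦
      Submodule.neg_mem _ (hφ.map_vertical y _ (hW.2 y))⟩
  have hφY : φ.app (-(φ.app W)) = W := by
    funext y
    change φ y (-(φ y (W y))) = W y
    rw [map_neg, hM.phi_phi, hM.eta_vertical hφ.xi_horizontal (hW.2 y)]
    simp
  have key : ∀ {X Z : VecField E M}, IsSmoothSectionOf (horizontal (E' := E') F) X →
      IsSmoothSectionOf (horizontal (E' := E') F) Z → koszul X W Z x = 0 := by
    intro X Z hX hZ
    have h := hA X _ hX hY x
    rw [hφY, oneillA_eq_zero_iff hX.2 hW.2] at h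
    rw [← inner_leviCivita (hX.1.mdifferentiableAt x) (hW.1.mdifferentiableAt x)
      (hZ.1.mdifferentiableAt x)]
    exact h _ (hZ.2 x)
  exact _root_.inner_bracket_eq_zero hX.2 hZ.2 hW.2 (key hX hZ) (key hZ hX)

/-- If `𝒯_V (φ W) = 0` for vertical `V` and `W`, then `g (∇_V Z, U) = 0` for vertical `V`, `U` and
horizontal `Z`, because `Z = φ W + η (Z) ξ` with `W = - φ Z`. -/
lemma IsCosymplectic.koszul_eq_zero (hM : IsCosymplectic φ ξ η) (hφ : ExchangesFibres E' φ ξ F)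
    (hT : ∀ V W : VecField E M,
        IsSmoothSectionOf (vertical (E' := E') F) V →
        IsSmoothSectionOf (vertical (E' := E') F) W →
        ∀ x : M, oneillT E' F V (φ.app W) x = 0)
    {V Z U : VecField E M} (hV : IsSmoothSectionOf (vertical (E' := E') F) V)
    (hZ : IsSmoothSectionOf (horizontal (E' := E') F) Z)
    (hU : IsSmoothSectionOf (vertical (E' := E') F) U) (x : M) : koszul V U Z x = 0 := by
  have hW : IsSmoothSectionOf (vertical (E' := E') F) (-(φ.app Z)) :=
    ⟨(hM.smooth_phi.app hZ.1).neg, fun y ↦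
      Submodule.neg_mem _ (hφ.map_horizontal y _ (hZ.2 y))⟩
  have hφW : ∀ y, φ.app (-(φ.app Z)) y ∈ horizontal (E' := E') F y := fun y ↦
    hφ.map_vertical y _ (hW.2 y)
  have hZx : Z x = φ.app (-(φ.app Z)) x + η x (Z x) • ξ x := by
    change Z x = φ x (-(φ x (Z x))) + η x (Z x) • ξ x
    rw [map_neg, hM.phi_phi]
    abel
  have hVd := hV.1.mdifferentiableAt x
  have hUd := hU.1.mdifferentiableAt x
  have hWd := (hM.smooth_phi.app hW.1).mdifferentiableAt x
  have h1 : koszul V U (φ.app (-(φ.app Z))) x = 0 := by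
    have h := hT V _ hV hW x
    rw [oneillT_eq_zero_iff hV.2 hφW] at h
    have h2 := h _ (hU.2 x)
    rw [inner_leviCivita hVd hWd hUd, koszul_vert_hor hφW hU.2] at h2
    linarith
  rw [← inner_leviCivita hVd hUd (hZ.1.mdifferentiableAt x), hZx, inner_add_right,
    inner_smul_right, inner_leviCivita hVd hUd hWd, h1,
    inner_leviCivita hVd hUd (hM.smooth_xi.mdifferentiableAt x), hM.koszul_xi hφ hV hU x]
  simp

end Cosymplectic

/-! ### Coordinate fields and the metric in coordinates -/

section Charts

variable {E : Type*} [NormedAddCommGroup E] [NormedSpace ℝ E]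
  {M : Type*} [TopologicalSpace M] [ChartedSpace E M]
  {V : Type*} [NormedAddCommGroup V] [NormedSpace ℝ V]

/-- `e` is a diffeomorphism of an open subset of `M` onto an open subset of `V`. The space `V` need
not be the model space of `M`. -/
structure IsSmoothChart (e : OpenPartialHomeomorph M V) : Prop where
  smooth : ContMDiffOn 𝓘(ℝ, E) 𝓘(ℝ, V) ∞ e e.source
  smooth_symm : ContMDiffOn 𝓘(ℝ, V) 𝓘(ℝ, E) ∞ e.symm e.target

/-- The vector field on the source of the chart `e` whose coordinate expression is `W`. -/
def coordField (e : OpenPartialHomeomorph M V) (W : V → V) : VecField E M :=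
  VectorField.mpullback 𝓘(ℝ, E) 𝓘(ℝ, V) e W

namespace IsSmoothChart

variable {e : OpenPartialHomeomorph M V} {q : M}

lemma contMDiffAt (he : IsSmoothChart (E := E) e) (hq : q ∈ e.source) :
    ContMDiffAt 𝓘(ℝ, E) 𝓘(ℝ, V) ∞ e q :=
  he.smooth.contMDiffAt (e.open_source.mem_nhds hq)

lemma mdifferentiableAt (he : IsSmoothChart (E := E) e) (hq : q ∈ e.source) :
    MDifferentiableAt 𝓘(ℝ, E) 𝓘(ℝ, V) e q :=
  (he.contMDiffAt hq).mdifferentiableAt (by simp)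

lemma mdifferentiable (he : IsSmoothChart (E := E) e) :
    e.MDifferentiable 𝓘(ℝ, E) 𝓘(ℝ, V) :=
  ⟨he.smooth.mdifferentiableOn (by simp), he.smooth_symm.mdifferentiableOn (by simp)⟩

lemma isInvertible (he : IsSmoothChart (E := E) e) (hq : q ∈ e.source) :
    (mfderiv 𝓘(ℝ, E) 𝓘(ℝ, V) e q).IsInvertible :=
  ⟨he.mdifferentiable.mfderiv hq, rfl⟩

lemma mvfderiv_injective (he : IsSmoothChart (E := E) e) (hq : q ∈ e.source) :
    Function.Injective (mvfderiv 𝓘(ℝ, E) e q) :=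
  he.mdifferentiable.mfderiv_injective hq

lemma mvfderiv_coordField (he : IsSmoothChart (E := E) e) (hq : q ∈ e.source) (W : V → V) :
    mvfderiv 𝓘(ℝ, E) e q (coordField e W q) = W (e q) :=
  (he.isInvertible hq).self_apply_inverse _

lemma coordField_mvfderiv (he : IsSmoothChart (E := E) e) (hq : q ∈ e.source)
    (v : TangentSpace 𝓘(ℝ, E) q) :
    coordField e (fun _ ↦ mvfderiv 𝓘(ℝ, E) e q v) q = v :=
  he.mvfderiv_injective hq (he.mvfderiv_coordField hq _)

variable [IsManifold 𝓘(ℝ, E) ∞ M]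

lemma contMDiffOn_coordField [CompleteSpace E] (he : IsSmoothChart (E := E) e) {W : V → V}
    (hW : ContDiffOn ℝ ∞ W e.target) :
    CMDiff[e.source] ∞ (T% (coordField (E := E) e W)) := by
  intro q hq
  have hWq : ContMDiffAt 𝓘(ℝ, V) (𝓘(ℝ, V).prod 𝓘(ℝ, V)) ∞
      (fun z ↦ (⟨z, W z⟩ : TangentBundle 𝓘(ℝ, V) V)) (e q) :=
    contMDiffAt_vectorSpace_iff_contDiffAt.2
      (hW.contDiffAt (e.open_target.mem_nhds (e.map_source hq)))
  exact (ContMDiffAt.mpullback_vectorField_preimage (n := ∞) hWq (he.contMDiffAt hq)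
    (he.isInvertible hq) (by simp)).contMDiffWithinAt

end IsSmoothChart

/-- A section of a distribution over an open set agrees near a given point of it with a global
section. -/
lemma exists_isSmoothSectionOf_eventuallyEq [FiniteDimensional ℝ E] [T2Space M]
    [IsManifold 𝓘(ℝ, E) ∞ M]
    {D : TangentDistribution E M} {X : VecField E M} {U : Set M} (hU : IsOpen U)
    (hX : CMDiff[U] ∞ (T% X)) (hXD : ∀ q ∈ U, X q ∈ D q) {p : M} (hp : p ∈ U) :
    ∃ X' : VecField E M, IsSmoothSectionOf D X' ∧ X' =ᶠ[𝓝 p] X := by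
  obtain ⟨f, -, hf⟩ := (SmoothBumpFunction.nhds_basis_tsupport (I := 𝓘(ℝ, E)) p).mem_iff.1
    (hU.mem_nhds hp)
  refine ⟨(f : M → ℝ) • X, ⟨?_, fun q ↦ ?_⟩, ?_⟩
  · exact ContMDiffOn.smul_section_of_tsupport f.contMDiff.contMDiffOn hU hf hX
  · by_cases hq : q ∈ U
    · exact Submodule.smul_mem _ _ (hXD q hq)
    · have h0 : f q = 0 := image_eq_zero_of_notMem_tsupport fun h ↦ hq (hf h)
      have h1 : ((f : M → ℝ) • X) q = 0 := by
        change f q • X q = 0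
        rw [h0, zero_smul]
      rw [h1]
      exact Submodule.zero_mem _
  · filter_upwards [f.eventuallyEq_one] with q hq
    change f q • X q = X q
    rw [hq, Pi.one_apply, one_smul]

variable [Bundle.RiemannianBundle (fun x : M ↦ TangentSpace 𝓘(ℝ, E) x)]

/-- The metric of `M` in the chart `e`, as a bilinear form on `V` that depends on a point of the
target of `e`. -/
def coordMetric (e : OpenPartialHomeomorph M V) (z : V) : V →L[ℝ] V →L[ℝ] ℝ :=
  let A : V →L[ℝ] TangentSpace 𝓘(ℝ, E) (e.symm z) := (mfderiv 𝓘(ℝ, E) 𝓘(ℝ, V) e (e.symm z)).inverse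
  (innerSL ℝ).bilinearComp A A

lemma coordMetric_apply (e : OpenPartialHomeomorph M V) (z a b : V) :
    coordMetric (E := E) e z a b =
      metricFun (E := E) (coordField e fun _ ↦ a) (coordField e fun _ ↦ b) (e.symm z) := rfl

namespace IsSmoothChart

variable {e : OpenPartialHomeomorph M V} {q : M}

lemma coordMetric_mvfderiv (he : IsSmoothChart (E := E) e) (hq : q ∈ e.source)
    (v w : TangentSpace 𝓘(ℝ, E) q) :
    coordMetric (E := E) e (e q) (mvfderiv 𝓘(ℝ, E) e q v) (mvfderiv 𝓘(ℝ, E) e q w) =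
      inner ℝ v w := by
  rw [coordMetric_apply, e.left_inv hq, metricFun, he.coordField_mvfderiv hq,
    he.coordField_mvfderiv hq]

lemma coordMetric_comm (z a b : V) :
    coordMetric (E := E) e z a b = coordMetric (E := E) e z b a := by
  rw [coordMetric_apply, metricFun_comm, coordMetric_apply]

lemma coordMetric_self_pos (he : IsSmoothChart (E := E) e) {z : V} (hz : z ∈ e.target) {a : V}
    (ha : a ≠ 0) : 0 < coordMetric (E := E) e z a a := by
  rw [coordMetric_apply, metricFun]
  refine real_inner_self_pos.2 fun h ↦ ha ?_
  have h1 := he.mvfderiv_coordField (e.map_target hz) fun _ ↦ a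
  rw [h, map_zero] at h1
  exact h1.symm

lemma contDiffOn_coordMetric [IsManifold 𝓘(ℝ, E) ∞ M] [FiniteDimensional ℝ V]
    [FiniteDimensional ℝ E]
    [IsContMDiffRiemannianBundle 𝓘(ℝ, E) ∞ E (fun x : M ↦ TangentSpace 𝓘(ℝ, E) x)]
    (he : IsSmoothChart (E := E) e) :
    ContDiffOn ℝ ∞ (coordMetric (E := E) e) e.target := by
  rw [contDiffOn_clm_apply]
  intro a
  rw [contDiffOn_clm_apply]
  intro b
  have h : ContMDiffOn 𝓘(ℝ, E) 𝓘(ℝ, ℝ) ∞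
      (metricFun (E := E) (coordField e fun _ ↦ a) (coordField e fun _ ↦ b)) e.source :=
    ContMDiffOn.inner_bundle (he.contMDiffOn_coordField contDiffOn_const)
      (he.contMDiffOn_coordField contDiffOn_const)
  exact (h.comp he.smooth_symm fun z hz ↦ e.map_target hz).contDiffOn

lemma isMetricOn_coordMetric [IsManifold 𝓘(ℝ, E) ∞ M] [FiniteDimensional ℝ V]
    [FiniteDimensional ℝ E]
    [IsContMDiffRiemannianBundle 𝓘(ℝ, E) ∞ E (fun x : M ↦ TangentSpace 𝓘(ℝ, E) x)]
    (he : IsSmoothChart (E := E) e) : IsMetricOn (coordMetric (E := E) e) e.target :=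
  ⟨e.open_target, he.contDiffOn_coordMetric, fun _ _ ↦ coordMetric_comm _,
    fun _ hz _ ↦ he.coordMetric_self_pos hz⟩

end IsSmoothChart

end Charts

/-! ### The connection of a local product -/

section Product

variable {E : Type*} [NormedAddCommGroup E] [NormedSpace ℝ E]
  {M : Type*} [TopologicalSpace M] [ChartedSpace E M]
  {B₁ : Type*} [NormedAddCommGroup B₁] [NormedSpace ℝ B₁]
  {B₂ : Type*} [NormedAddCommGroup B₂] [NormedSpace ℝ B₂]

set_option synthInstance.maxHeartbeats 200000 in
lemma mvfderiv_bilin {g : B₂ → B₂ →L[ℝ] B₂ →L[ℝ] ℝ} {h a c : M → B₂} {x : M}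
    (hg : DifferentiableAt ℝ g (h x)) (hh : MDifferentiableAt 𝓘(ℝ, E) 𝓘(ℝ, B₂) h x)
    (ha : MDifferentiableAt 𝓘(ℝ, E) 𝓘(ℝ, B₂) a x) (hc : MDifferentiableAt 𝓘(ℝ, E) 𝓘(ℝ, B₂) c x)
    (v : TangentSpace 𝓘(ℝ, E) x) :
    mvfderiv 𝓘(ℝ, E) (fun q ↦ g (h q) (a q) (c q)) x v =
      fderiv ℝ g (h x) (mvfderiv 𝓘(ℝ, E) h x v) (a x) (c x) +
        g (h x) (mvfderiv 𝓘(ℝ, E) a x v) (c x) + g (h x) (a x) (mvfderiv 𝓘(ℝ, E) c x v) := by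
  have hgh : MDifferentiableAt 𝓘(ℝ, E) 𝓘(ℝ, B₂ →L[ℝ] B₂ →L[ℝ] ℝ) (fun q ↦ g (h q)) x :=
    mdifferentiableAt_fun_comp hg hh
  rw [mvfderiv_clm_apply (mdifferentiableAt_clm_apply hgh ha) hc, mvfderiv_clm_apply hgh ha,
    mvfderiv_fun_comp hg hh]
  rfl

variable [IsManifold 𝓘(ℝ, E) ∞ M] [CompleteSpace E]
  [Bundle.RiemannianBundle (fun x : M ↦ TangentSpace 𝓘(ℝ, E) x)]

set_option synthInstance.maxHeartbeats 200000 in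
/-- On a local product with projections `h₁` and `h₂`, the covariant derivative along the second
factor of a field tangent to the first factor has no component along the second factor. -/
lemma koszul_eq_zero_of_product {h₁ : M → B₁} {h₂ : M → B₂} {g₁ : B₁ → B₁ →L[ℝ] B₁ →L[ℝ] ℝ}
    {g₂ : B₂ → B₂ →L[ℝ] B₂ →L[ℝ] ℝ} {x : M} (hh₁ : ContMDiffAt 𝓘(ℝ, E) 𝓘(ℝ, B₁) ∞ h₁ x)
    (hh₂ : ContMDiffAt 𝓘(ℝ, E) 𝓘(ℝ, B₂) ∞ h₂ x) (hg₂ : DifferentiableAt ℝ g₂ (h₂ x))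
    (hsymm : ∀ a b, g₂ (h₂ x) a b = g₂ (h₂ x) b a)
    (hg : ∀ᶠ q in 𝓝 x, ∀ v w : TangentSpace 𝓘(ℝ, E) q, inner ℝ v w =
      g₁ (h₁ q) (mvfderiv 𝓘(ℝ, E) h₁ q v) (mvfderiv 𝓘(ℝ, E) h₁ q w) +
        g₂ (h₂ q) (mvfderiv 𝓘(ℝ, E) h₂ q v) (mvfderiv 𝓘(ℝ, E) h₂ q w))
    {X W Z : VecField E M} (hX : MDiffAt (T% X) x) (hW : MDiffAt (T% W) x)
    (hZ : MDiffAt (T% Z) x)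
    (hX₁ : ∀ᶠ q in 𝓝 x, mvfderiv 𝓘(ℝ, E) h₁ q (X q) = 0)
    (hZ₁ : ∀ᶠ q in 𝓝 x, mvfderiv 𝓘(ℝ, E) h₁ q (Z q) = 0)
    (hW₂ : ∀ᶠ q in 𝓝 x, mvfderiv 𝓘(ℝ, E) h₂ q (W q) = 0) :
    koszul X W Z x = 0 := by
  have hWZ : ∀ᶠ q in 𝓝 x, metricFun W Z q = 0 := by
    filter_upwards [hg, hZ₁, hW₂] with q h1 h2 h3
    simp [metricFun, h1, h2, h3]
  have hXW : ∀ᶠ q in 𝓝 x, metricFun X W q = 0 := by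
    filter_upwards [hg, hX₁, hW₂] with q h1 h2 h3
    simp [metricFun, h1, h2, h3]
  have hXZ : metricFun X Z =ᶠ[𝓝 x] fun q ↦
      g₂ (h₂ q) (mvfderiv 𝓘(ℝ, E) h₂ q (X q)) (mvfderiv 𝓘(ℝ, E) h₂ q (Z q)) := by
    filter_upwards [hg, hX₁, hZ₁] with q h1 h2 h3
    simp [metricFun, h1, h2, h3]
  simp only [koszul, lieDer_of_eventually_eq_const hWZ, lieDer_of_eventually_eq_const hXW,
    lieDer_congr hXZ, hg.self_of_nhds, mvfderiv_bracket hh₁ hX hZ, mvfderiv_bracket hh₂ hX hW,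
    mvfderiv_bracket hh₂ hW hZ, mvfderiv_of_eventually_eq_zero hX₁,
    mvfderiv_of_eventually_eq_zero hZ₁, mvfderiv_of_eventually_eq_zero hW₂, hX₁.self_of_nhds,
    hZ₁.self_of_nhds, hW₂.self_of_nhds]
  rw [lieDer, mvfderiv_bilin hg₂ (hh₂.mdifferentiableAt (by simp))
    (mdifferentiableAt_mvfderiv_apply hh₂ hX) (mdifferentiableAt_mvfderiv_apply hh₂ hZ),
    hW₂.self_of_nhds]
  simp [hsymm (mvfderiv 𝓘(ℝ, E) h₂ x (X x))]

end Product

section ProductSections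

variable {E : Type*} [NormedAddCommGroup E] [NormedSpace ℝ E] [FiniteDimensional ℝ E]
  {M : Type*} [TopologicalSpace M] [ChartedSpace E M] [IsManifold 𝓘(ℝ, E) ∞ M]
  [Bundle.RiemannianBundle (fun x : M ↦ TangentSpace 𝓘(ℝ, E) x)]
  [IsContMDiffRiemannianBundle 𝓘(ℝ, E) ∞ E (fun x : M ↦ TangentSpace 𝓘(ℝ, E) x)]
  {B : Type*} [NormedAddCommGroup B] [NormedSpace ℝ B]
  {B₁ : Type*} [NormedAddCommGroup B₁] [NormedSpace ℝ B₁]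
  {B₂ : Type*} [NormedAddCommGroup B₂] [NormedSpace ℝ B₂]

/-- The form of `koszul_eq_zero_of_product` for a chart `e` with values in a space `B` and the
projections `P₁`, `P₂` of `B`. -/
lemma IsSmoothChart.inner_leviCivita_eq_zero {e : OpenPartialHomeomorph M B}
    (he : IsSmoothChart (E := E) e) (P₁ : B →L[ℝ] B₁) (P₂ : B →L[ℝ] B₂)
    {g₁ : B₁ → B₁ →L[ℝ] B₁ →L[ℝ] ℝ} {g₂ : B₂ → B₂ →L[ℝ] B₂ →L[ℝ] ℝ} {x : M} (hx : x ∈ e.source)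
    (hg₂ : DifferentiableAt ℝ g₂ (P₂ (e x)))
    (hsymm : ∀ a b, g₂ (P₂ (e x)) a b = g₂ (P₂ (e x)) b a)
    (hg : ∀ q ∈ e.source, ∀ v w : TangentSpace 𝓘(ℝ, E) q, inner ℝ v w =
      g₁ (P₁ (e q)) (P₁ (mvfderiv 𝓘(ℝ, E) e q v)) (P₁ (mvfderiv 𝓘(ℝ, E) e q w)) +
        g₂ (P₂ (e q)) (P₂ (mvfderiv 𝓘(ℝ, E) e q v)) (P₂ (mvfderiv 𝓘(ℝ, E) e q w)))
    {X W : VecField E M} (hX : MDiffAt (T% X) x) (hW : MDiffAt (T% W) x)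
    (hX₁ : ∀ q ∈ e.source, P₁ (mvfderiv 𝓘(ℝ, E) e q (X q)) = 0)
    (hW₂ : ∀ q ∈ e.source, P₂ (mvfderiv 𝓘(ℝ, E) e q (W q)) = 0)
    {z : TangentSpace 𝓘(ℝ, E) x} (hz : P₁ (mvfderiv 𝓘(ℝ, E) e x z) = 0) :
    inner ℝ (leviCivita X W x) z = (0 : ℝ) := by
  have hsrc : ∀ᶠ q in 𝓝 x, q ∈ e.source := e.open_source.mem_nhds hx
  have h₁ : ∀ q ∈ e.source, ∀ v : TangentSpace 𝓘(ℝ, E) q,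
      mvfderiv 𝓘(ℝ, E) (fun y ↦ P₁ (e y)) q v = P₁ (mvfderiv 𝓘(ℝ, E) e q v) := fun q hq v ↦
    mvfderiv_clm_comp P₁ (he.mdifferentiableAt hq) v
  have h₂ : ∀ q ∈ e.source, ∀ v : TangentSpace 𝓘(ℝ, E) q,
      mvfderiv 𝓘(ℝ, E) (fun y ↦ P₂ (e y)) q v = P₂ (mvfderiv 𝓘(ℝ, E) e q v) := fun q hq v ↦
    mvfderiv_clm_comp P₂ (he.mdifferentiableAt hq) v
  have hext : MDiffAt (T% (coordField (E := E) e fun _ ↦ mvfderiv 𝓘(ℝ, E) e x z)) x :=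
    ((he.contMDiffOn_coordField contDiffOn_const).contMDiffAt
      (e.open_source.mem_nhds hx)).mdifferentiableAt (by simp)
  rw [← he.coordField_mvfderiv hx z, inner_leviCivita hX hW hext]
  refine koszul_eq_zero_of_product (h₁ := fun y ↦ P₁ (e y)) (h₂ := fun y ↦ P₂ (e y)) (g₁ := g₁)
    (g₂ := g₂) (P₁.contDiff.contMDiff.contMDiffAt.comp x (he.contMDiffAt hx))
    (P₂.contDiff.contMDiff.contMDiffAt.comp x (he.contMDiffAt hx)) hg₂ hsymm ?_ hX hW hext ?_ ?_ ?_
  · filter_upwards [hsrc] with q hq v w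
    rw [h₁ q hq, h₁ q hq, h₂ q hq, h₂ q hq]
    exact hg q hq v w
  · filter_upwards [hsrc] with q hq
    rw [h₁ q hq, hX₁ q hq]
  · filter_upwards [hsrc] with q hq
    rw [h₁ q hq, he.mvfderiv_coordField hq, hz]
  · filter_upwards [hsrc] with q hq
    rw [h₂ q hq, hW₂ q hq]

/-- On a local product, covariant differentiation along one factor preserves the fields tangent to
the other one. -/
lemma IsLocallyProduct.inner_leviCivita_eq_zero {D₁ D₂ : TangentDistribution E M}
    (hD : IsLocallyProduct D₁ D₂) {X W : VecField E M} (hX : IsSmoothSectionOf D₂ X)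
    (hW : IsSmoothSectionOf D₁ W) (x : M) :
    (∀ z ∈ D₂ x, inner ℝ (leviCivita X W x) z = (0 : ℝ)) ∧
      ∀ u ∈ D₁ x, inner ℝ (leviCivita W X x) u = (0 : ℝ) := by
  obtain ⟨k, l, U₁, U₂, g₁, g₂, e, hg₁, hg₂, hx, htarget, hes, hes', hprod⟩ := hD x
  have he : IsSmoothChart (E := E) e := ⟨hes, hes'⟩
  have hex : (e x).1 ∈ U₁ ∧ (e x).2 ∈ U₂ := by
    have h := e.map_source hx
    rwa [htarget] at h
  have hd₁ : DifferentiableAt ℝ g₁ (e x).1 :=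
    (hg₁.smooth.contDiffAt (hg₁.isOpen.mem_nhds hex.1)).differentiableAt (by simp)
  have hd₂ : DifferentiableAt ℝ g₂ (e x).2 :=
    (hg₂.smooth.contDiffAt (hg₂.isOpen.mem_nhds hex.2)).differentiableAt (by simp)
  have hXd := hX.1.mdifferentiableAt x
  have hWd := hW.1.mdifferentiableAt x
  refine ⟨fun z hz ↦ ?_, fun u hu ↦ ?_⟩
  · exact he.inner_leviCivita_eq_zero (.fst ℝ _ _) (.snd ℝ _ _) (g₁ := g₁) hx hd₂
      (hg₂.symm _ hex.2) (fun q hq ↦ (hprod q hq).2.2) hXd hWd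
      (fun q hq ↦ ((hprod q hq).2.1 _).1 (hX.2 q)) (fun q hq ↦ ((hprod q hq).1 _).1 (hW.2 q))
      (((hprod x hx).2.1 z).1 hz)
  · exact he.inner_leviCivita_eq_zero (.snd ℝ _ _) (.fst ℝ _ _) (g₁ := g₂) hx hd₁
      (hg₁.symm _ hex.1) (fun q hq v w ↦ ((hprod q hq).2.2 v w).trans (add_comm _ _)) hWd hXd
      (fun q hq ↦ ((hprod q hq).1 _).1 (hW.2 q)) (fun q hq ↦ ((hprod q hq).2.1 _).1 (hX.2 q))
      (((hprod x hx).1 u).1 hu)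

end ProductSections

/-! ### Charts adapted to a Riemannian submersion -/

section ChartConstructions

variable {E : Type*} [NormedAddCommGroup E] [NormedSpace ℝ E]
  {M : Type*} [TopologicalSpace M] [ChartedSpace E M]
  {V : Type*} [NormedAddCommGroup V] [NormedSpace ℝ V]
  {V' : Type*} [NormedAddCommGroup V'] [NormedSpace ℝ V']

lemma isSmoothChart_chartAt [IsManifold 𝓘(ℝ, E) ∞ M] (p : M) :
    IsSmoothChart (E := E) (chartAt E p) :=
  ⟨contMDiffOn_chart, contMDiffOn_chart_symm⟩

lemma IsSmoothChart.trans {e : OpenPartialHomeomorph M V} (he : IsSmoothChart (E := E) e)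
    {Θ : OpenPartialHomeomorph V V'} (hΘ : ContDiffOn ℝ ∞ Θ Θ.source)
    (hΘ' : ContDiffOn ℝ ∞ Θ.symm Θ.target) : IsSmoothChart (E := E) (e.trans Θ) where
  smooth := by
    refine hΘ.contMDiffOn.comp (he.smooth.mono fun q hq ↦ ?_) fun q hq ↦ ?_
    · exact (by simpa using hq : q ∈ e.source ∧ e q ∈ Θ.source).1
    · exact (by simpa using hq : q ∈ e.source ∧ e q ∈ Θ.source).2
  smooth_symm := by
    refine he.smooth_symm.comp (hΘ'.contMDiffOn.mono fun z hz ↦ ?_) fun z hz ↦ ?_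
    · exact (by simpa using hz : z ∈ Θ.target ∧ Θ.symm z ∈ e.target).1
    · exact (by simpa using hz : z ∈ Θ.target ∧ Θ.symm z ∈ e.target).2

/-- The restriction of a chart to the preimage of an open subset of its target. -/
lemma IsSmoothChart.exists_target_eq {e : OpenPartialHomeomorph M V}
    (he : IsSmoothChart (E := E) e) {U : Set V} (hU : IsOpen U) (hUe : U ⊆ e.target) :
    ∃ e' : OpenPartialHomeomorph M V, IsSmoothChart (E := E) e' ∧ e'.target = U ∧
      (∀ q, e' q = e q) ∧ e'.source ⊆ e.source ∧ ∀ q ∈ e.source, e q ∈ U → q ∈ e'.source := by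
  have htarget : (e.symm.restrOpen U hU).symm.target = U := by
    simpa using hUe
  have hsource : (e.symm.restrOpen U hU).symm.source ⊆ e.source := fun q hq ↦ by
    have h := (e.symm.restrOpen U hU).symm.map_source hq
    rw [htarget] at h
    have h1 := (e.symm.restrOpen U hU).symm.left_inv hq
    rw [← h1]
    exact e.map_target (hUe h)
  refine ⟨(e.symm.restrOpen U hU).symm, ⟨he.smooth.mono hsource, ?_⟩, htarget, fun q ↦ rfl,
    hsource, fun q hq hqU ↦ ?_⟩
  · rw [htarget]
    exact he.smooth_symm.mono hUe
  · have h := (e.symm.restrOpen U hU).symm.map_target (x := e q) (by rwa [htarget])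
    have h1 : (e.symm.restrOpen U hU).symm.symm (e q) = q := e.left_inv hq
    rwa [h1] at h

/-- A surjective linear map can be completed to an isomorphism onto a product. -/
lemma exists_continuousLinearEquiv_prod_of_surjective [FiniteDimensional ℝ V]
    {B : Type*} [NormedAddCommGroup B] [NormedSpace ℝ B] [FiniteDimensional ℝ B]
    [FiniteDimensional ℝ V'] (D : V →L[ℝ] V') (hD : Function.Surjective D)
    (hdim : Module.finrank ℝ B + Module.finrank ℝ V' = Module.finrank ℝ V) :
    ∃ (P : V →L[ℝ] B) (T : V ≃L[ℝ] V' × B), ∀ v, T v = (D v, P v) := by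
  have hker : Module.finrank ℝ D.ker = Module.finrank ℝ B := by
    have h := LinearMap.finrank_range_add_finrank_ker D.toLinearMap
    rw [LinearMap.range_eq_top.2 hD, finrank_top] at h
    have h' : Module.finrank ℝ (LinearMap.ker D.toLinearMap) = Module.finrank ℝ B := by omega
    exact h'
  let i : D.ker ≃L[ℝ] B := ContinuousLinearEquiv.ofFinrankEq hker
  obtain ⟨pr, hpr⟩ := D.ker_closedComplemented_of_finiteDimensional_range
  let P : V →L[ℝ] B := (i : D.ker →L[ℝ] B) ∘L pr
  have hinj : Function.Injective (D.prod P) := by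
    refine (injective_iff_map_eq_zero _).2 fun v hv ↦ ?_
    have h1 : D v = 0 := congrArg Prod.fst hv
    have h2 : i (pr v) = 0 := congrArg Prod.snd hv
    rw [i.map_eq_zero_iff, hpr ⟨v, h1⟩] at h2
    exact congrArg Subtype.val h2
  have hfin : Module.finrank ℝ V = Module.finrank ℝ (V' × B) := by
    rw [Module.finrank_prod, ← hdim, add_comm]
  exact ⟨P, (LinearEquiv.ofInjectiveOfFinrankEq (D.prod P).toLinearMap hinj
    hfin).toContinuousLinearEquiv, fun v ↦ rfl⟩

end ChartConstructions

section AdaptedCharts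

variable {E : Type*} [NormedAddCommGroup E] [NormedSpace ℝ E]
  {M : Type*} [TopologicalSpace M] [ChartedSpace E M]
  [Bundle.RiemannianBundle (fun x : M ↦ TangentSpace 𝓘(ℝ, E) x)]
  {E' : Type*} [NormedAddCommGroup E'] [NormedSpace ℝ E']
  {N : Type*} [TopologicalSpace N] [ChartedSpace E' N]
  [Bundle.RiemannianBundle (fun y : N ↦ TangentSpace 𝓘(ℝ, E') y)]
  {F : M → N}

lemma IsRiemannianSubmersion.inner_map (hF : IsRiemannianSubmersion (E := E) (E' := E') F) {x : M}
    {v w : TangentSpace 𝓘(ℝ, E) x} (hv : v ∈ horizontal (E' := E') F x)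
    (hw : w ∈ horizontal (E' := E') F x) :
    inner ℝ (mfderiv 𝓘(ℝ, E) 𝓘(ℝ, E') F x v) (mfderiv 𝓘(ℝ, E) 𝓘(ℝ, E') F x w) =
      (inner ℝ v w : ℝ) := by
  rw [real_inner_eq_norm_add_mul_self_sub_norm_mul_self_sub_norm_mul_self_div_two,
    real_inner_eq_norm_add_mul_self_sub_norm_mul_self_sub_norm_mul_self_div_two,
    ← map_add, hF.norm_map x _ hv, hF.norm_map x _ hw, hF.norm_map x _ (Submodule.add_mem _ hv hw)]

/-- A chart `e` with values in a product such that the vertical distribution is tangent to the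
second factor and the metric of horizontal vectors is given by a metric `g` on a subset `U` of the
first factor. -/
structure IsAdaptedChart {X Y : Type*} [NormedAddCommGroup X] [NormedSpace ℝ X]
    [NormedAddCommGroup Y] [NormedSpace ℝ Y] (E' : Type*) [NormedAddCommGroup E']
    [NormedSpace ℝ E'] {N : Type*} [TopologicalSpace N] [ChartedSpace E' N] (F : M → N)
    (U : Set X) (g : X → X →L[ℝ] X →L[ℝ] ℝ) (e : OpenPartialHomeomorph M (X × Y)) : Prop
    extends IsSmoothChart (E := E) e where
  fst_mem : ∀ q ∈ e.source, (e q).1 ∈ U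
  mem_vertical_iff : ∀ q ∈ e.source, ∀ v : TangentSpace 𝓘(ℝ, E) q,
    v ∈ vertical (E' := E') F q ↔ (mvfderiv 𝓘(ℝ, E) e q v).1 = 0
  inner_eq : ∀ q ∈ e.source, ∀ v ∈ horizontal (E := E) (E' := E') F q,
    ∀ w ∈ horizontal (E := E) (E' := E') F q,
    inner ℝ v w = g (e q).1 (mvfderiv 𝓘(ℝ, E) e q v).1 (mvfderiv 𝓘(ℝ, E) e q w).1

lemma IsRiemannianSubmersion.finrank_le [FiniteDimensional ℝ E]
    (hF : IsRiemannianSubmersion (E := E) (E' := E') F) (p : M) :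
    Module.finrank ℝ E' ≤ Module.finrank ℝ E := by
  let D : E →ₗ[ℝ] E' := (mfderiv 𝓘(ℝ, E) 𝓘(ℝ, E') F p).toLinearMap
  exact LinearMap.finrank_le_finrank_of_surjective (f := D) (hF.maximal_rank p)

/-- The first component of the adapted chart is `F`, read in a chart `u` of `N`, and `g` is the
metric of `N` in that chart. -/
lemma IsRiemannianSubmersion.exists_isAdaptedChart [FiniteDimensional ℝ E]
    [FiniteDimensional ℝ E'] [IsManifold 𝓘(ℝ, E) ∞ M] [IsManifold 𝓘(ℝ, E') ∞ N]
    [IsContMDiffRiemannianBundle 𝓘(ℝ, E') ∞ E' (fun y : N ↦ TangentSpace 𝓘(ℝ, E') y)]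
    {X Y : Type*} [NormedAddCommGroup X] [NormedSpace ℝ X] [FiniteDimensional ℝ X]
    [NormedAddCommGroup Y] [NormedSpace ℝ Y] [FiniteDimensional ℝ Y]
    (hX : Module.finrank ℝ E' = Module.finrank ℝ X)
    (hY : Module.finrank ℝ Y + Module.finrank ℝ X = Module.finrank ℝ E)
    (hF : IsRiemannianSubmersion (E := E) (E' := E') F) (p : M) :
    ∃ (U : Set X) (g : X → X →L[ℝ] X →L[ℝ] ℝ) (e : OpenPartialHomeomorph M (X × Y)),
      IsMetricOn g U ∧ IsAdaptedChart (E := E) E' F U g e ∧ p ∈ e.source := by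
  let L : E' ≃L[ℝ] X := ContinuousLinearEquiv.ofFinrankEq hX
  let u : OpenPartialHomeomorph N X :=
    (chartAt E' (F p)).trans L.toHomeomorph.toOpenPartialHomeomorph
  have hu : IsSmoothChart (E := E') u :=
    (isSmoothChart_chartAt (F p)).trans L.contDiff.contDiffOn L.symm.contDiff.contDiffOn
  have hup : F p ∈ u.source := by simp [u]
  let κ : OpenPartialHomeomorph M E := chartAt E p
  have hκ : IsSmoothChart (E := E) κ := isSmoothChart_chartAt p
  have hκp : p ∈ κ.source := mem_chart_source E p
  let O : Set E := κ.target ∩ κ.symm ⁻¹' (F ⁻¹' u.source)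
  have hO : IsOpen O :=
    κ.isOpen_inter_preimage_symm (u.open_source.preimage hF.smooth.continuous)
  let f : E → X := fun z ↦ u (F (κ.symm z))
  have hf : ContDiffOn ℝ ∞ f O := by
    refine ContMDiffOn.contDiffOn ?_
    refine hu.smooth.comp (hF.smooth.comp_contMDiffOn (hκ.smooth_symm.mono inter_subset_left))
      fun z hz ↦ hz.2
  have hpO : κ p ∈ O := ⟨κ.map_source hκp, by
    change F (κ.symm (κ p)) ∈ u.source
    rwa [κ.left_inv hκp]⟩
  have hfd : ∀ z ∈ O, DifferentiableAt ℝ f z := fun z hz ↦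
    (hf.contDiffAt (hO.mem_nhds hz)).differentiableAt (by simp)
  have hFd : ∀ q, MDifferentiableAt 𝓘(ℝ, E) 𝓘(ℝ, E') F q := fun q ↦
    hF.smooth.mdifferentiableAt (by simp)
  have hchain : ∀ q, F q ∈ u.source → ∀ v : TangentSpace 𝓘(ℝ, E) q,
      mvfderiv 𝓘(ℝ, E) (fun y ↦ u (F y)) q v =
        mvfderiv 𝓘(ℝ, E') u (F q) (mfderiv 𝓘(ℝ, E) 𝓘(ℝ, E') F q v) := fun q hq v ↦
    mfderiv_comp_apply (g := u) q (hu.mdifferentiableAt hq) (hFd q) v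
  have hfκ : (fun y ↦ f (κ y)) =ᶠ[𝓝 p] fun y ↦ u (F y) := by
    filter_upwards [κ.open_source.mem_nhds hκp] with y hy
    change u (F (κ.symm (κ y))) = u (F y)
    rw [κ.left_inv hy]
  have hsurj : Function.Surjective (fderiv ℝ f (κ p)) := by
    intro a
    obtain ⟨b, hb⟩ := (hu.mdifferentiable.mfderiv_surjective hup) a
    obtain ⟨v, hv⟩ := hF.maximal_rank p b
    refine ⟨mvfderiv 𝓘(ℝ, E) κ p v, ?_⟩
    rw [← mvfderiv_fun_comp (hfd _ hpO) (hκ.mdifferentiableAt hκp), mvfderiv_congr hfκ,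
      hchain p hup, hv]
    exact hb
  obtain ⟨P, T, hT⟩ := exists_continuousLinearEquiv_prod_of_surjective (B := Y) (fderiv ℝ f (κ p))
    hsurj hY
  have hΞ : HasFDerivAt (fun z ↦ (f z, P z)) (T : E →L[ℝ] X × Y) (κ p) := by
    have h : (T : E →L[ℝ] X × Y) = (fderiv ℝ f (κ p)).prod P := ContinuousLinearMap.ext hT
    rw [h]
    exact (hfd _ hpO).hasFDerivAt.prodMk P.hasFDerivAt
  obtain ⟨e₁, he₁, hpe₁, he₁O, he₁s⟩ := exists_openPartialHomeomorph_of_contDiffOn hO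
    (hf.prodMk P.contDiff.contDiffOn) hpO T hΞ
  have he₁d : ContDiffOn ℝ ∞ e₁ e₁.source :=
    ((hf.prodMk P.contDiff.contDiffOn).mono he₁O).congr fun z _ ↦ he₁ z
  have he : IsSmoothChart (E := E) (κ.trans e₁) := hκ.trans he₁d he₁s
  have hsource : ∀ q ∈ (κ.trans e₁).source, F q ∈ u.source := fun q hq ↦ by
    have h : q ∈ κ.source ∧ κ q ∈ e₁.source := by simpa using hq
    have h1 : F (κ.symm (κ q)) ∈ u.source := (he₁O h.2).2
    rwa [κ.left_inv h.1] at h1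
  have hfst : ∀ q ∈ (κ.trans e₁).source, ((κ.trans e₁) q).1 = u (F q) := fun q hq ↦ by
    have h : q ∈ κ.source ∧ κ q ∈ e₁.source := by simpa using hq
    change (e₁ (κ q)).1 = _
    rw [he₁]
    change u (F (κ.symm (κ q))) = _
    rw [κ.left_inv h.1]
  have hd : ∀ q ∈ (κ.trans e₁).source, ∀ v : TangentSpace 𝓘(ℝ, E) q,
      (mvfderiv 𝓘(ℝ, E) (κ.trans e₁) q v).1 =
        mvfderiv 𝓘(ℝ, E') u (F q) (mfderiv 𝓘(ℝ, E) 𝓘(ℝ, E') F q v) := fun q hq v ↦ by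
    have h := mvfderiv_clm_comp (.fst ℝ X Y) (he.mdifferentiableAt hq) v
    rw [ContinuousLinearMap.coe_fst'] at h
    rw [← h, ← hchain q (hsource q hq)]
    congr 1
    refine mvfderiv_congr ?_
    filter_upwards [(κ.trans e₁).open_source.mem_nhds hq] with y hy using hfst y hy
  refine ⟨u.target, coordMetric (E := E') u, κ.trans e₁, hu.isMetricOn_coordMetric,
    ⟨he, fun q hq ↦ ?_, fun q hq v ↦ ?_,
    fun q hq v hv w hw ↦ ?_⟩, by simpa [hκp] using hpe₁⟩
  · rw [hfst q hq]
    exact u.map_source (hsource q hq)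
  · rw [hd q hq]
    exact ((hu.mvfderiv_injective (hsource q hq)).eq_iff' (map_zero _)).symm
  · rw [hd q hq, hd q hq, hfst q hq, hu.coordMetric_mvfderiv (hsource q hq), hF.inner_map hv hw]

end AdaptedCharts

/-! ### Integrability of the horizontal distribution -/

section Graph

variable {X Y : Type*} [NormedAddCommGroup X] [NormedSpace ℝ X] [FiniteDimensional ℝ X]
  [NormedAddCommGroup Y] [NormedSpace ℝ Y] [FiniteDimensional ℝ Y]

lemma isInvertible_of_forall_self_pos {g : Y →L[ℝ] Y →L[ℝ] ℝ} (hg : ∀ b, b ≠ 0 → 0 < g b b) :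
    g.IsInvertible := by
  have hinj : Function.Injective g := (injective_iff_map_eq_zero _).2 fun b hb ↦ by
    by_contra h
    have h1 := hg b h
    rw [hb] at h1
    exact lt_irrefl _ h1
  have hfin : Module.finrank ℝ Y = Module.finrank ℝ (Y →L[ℝ] ℝ) := by
    rw [← (LinearMap.toContinuousLinearMap : (Y →ₗ[ℝ] ℝ) ≃ₗ[ℝ] (Y →L[ℝ] ℝ)).finrank_eq]
    exact Subspace.dual_finrank_eq.symm
  exact ⟨(LinearEquiv.ofInjectiveOfFinrankEq g.toLinearMap hinj hfin).toContinuousLinearEquiv,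
    ContinuousLinearMap.ext fun b ↦ rfl⟩

set_option synthInstance.maxHeartbeats 200000 in
/-- With respect to a smooth metric on an open subset of `X × Y`, the orthogonal complement of the
tangent spaces of the second factor is the graph of a smooth family of linear maps. -/
lemma exists_graph_of_orthogonal {g : X × Y → X × Y →L[ℝ] X × Y →L[ℝ] ℝ} {Ω : Set (X × Y)}
    (hΩ : IsOpen Ω) (hg : ContDiffOn ℝ ∞ g Ω)
    (hpos : ∀ z ∈ Ω, ∀ w, w ≠ 0 → 0 < g z w w) :
    ∃ A : X × Y → X →L[ℝ] Y, ContDiffOn ℝ ∞ A Ω ∧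
      ∀ z ∈ Ω, ∀ w, (∀ b, g z w (0, b) = 0) ↔ w.2 = A z w.1 := by
  let gY : X × Y → Y →L[ℝ] Y →L[ℝ] ℝ := fun z ↦
    (g z).bilinearComp (.inr ℝ X Y) (.inr ℝ X Y)
  let gX : X × Y → X →L[ℝ] Y →L[ℝ] ℝ := fun z ↦
    (g z).bilinearComp (.inl ℝ X Y) (.inr ℝ X Y)
  have hgY : ContDiffOn ℝ ∞ gY Ω := contDiffOn_clm_apply.2 fun b ↦ contDiffOn_clm_apply.2 fun c ↦
    (hg.clm_apply contDiffOn_const).clm_apply contDiffOn_const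
  have hgX : ContDiffOn ℝ ∞ gX Ω := contDiffOn_clm_apply.2 fun b ↦ contDiffOn_clm_apply.2 fun c ↦
    (hg.clm_apply contDiffOn_const).clm_apply contDiffOn_const
  have hinv : ∀ z ∈ Ω, (gY z).IsInvertible := fun z hz ↦
    isInvertible_of_forall_self_pos fun b hb ↦ hpos z hz (0, b) fun h ↦ hb (congrArg Prod.snd h)
  refine ⟨fun z ↦ -((gY z).inverse ∘L gX z), ?_, fun z hz w ↦ ?_⟩
  · refine (ContDiffOn.clm_comp (fun z hz ↦ ?_) hgX).neg
    obtain ⟨i, hi⟩ := hinv z hz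
    have h := contDiffAt_map_inverse (n := ∞) i
    rw [hi] at h
    exact (h.comp z (hgY.contDiffAt (hΩ.mem_nhds hz))).contDiffWithinAt
  · have hsum : ∀ b, g z w (0, b) = gX z w.1 b + gY z w.2 b := fun b ↦ by
      change _ = g z (w.1, 0) (0, b) + g z (0, w.2) (0, b)
      rw [← add_apply, ← map_add]
      simp
    obtain ⟨i, hi⟩ := hinv z hz
    have hA : (-((gY z).inverse ∘L gX z)) w.1 = i.symm (-gX z w.1) := by
      rw [← hi, ContinuousLinearMap.inverse_equiv]
      simp
    rw [hA, ContinuousLinearEquiv.eq_symm_apply]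
    have hiw : i w.2 = gY z w.2 := congrArg (fun T : Y →L[ℝ] Y →L[ℝ] ℝ ↦ T w.2) hi
    rw [hiw]
    refine ⟨fun h ↦ ContinuousLinearMap.ext fun b ↦ ?_, fun h b ↦ ?_⟩
    · have := h b
      rw [hsum] at this
      rw [neg_apply]
      linarith
    · rw [hsum, h, neg_apply]
      ring

end Graph

section Flatness

variable {E : Type*} [NormedAddCommGroup E] [NormedSpace ℝ E] [FiniteDimensional ℝ E]
  {M : Type*} [TopologicalSpace M] [ChartedSpace E M] [IsManifold 𝓘(ℝ, E) ∞ M]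
  [Bundle.RiemannianBundle (fun x : M ↦ TangentSpace 𝓘(ℝ, E) x)]
  {E' : Type*} [NormedAddCommGroup E'] [NormedSpace ℝ E']
  {N : Type*} [TopologicalSpace N] [ChartedSpace E' N] {F : M → N}
  {X Y : Type*} [NormedAddCommGroup X] [NormedSpace ℝ X] [NormedAddCommGroup Y] [NormedSpace ℝ Y]
  {U : Set X} {g : X → X →L[ℝ] X →L[ℝ] ℝ} {e : OpenPartialHomeomorph M (X × Y)}

/-- In an adapted chart the horizontal distribution is the graph of a connection form `A`. -/
lemma IsAdaptedChart.exists_connectionForm [FiniteDimensional ℝ X] [FiniteDimensional ℝ Y]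
    [IsContMDiffRiemannianBundle 𝓘(ℝ, E) ∞ E (fun x : M ↦ TangentSpace 𝓘(ℝ, E) x)]
    (he : IsAdaptedChart (E := E) E' F U g e) :
    ∃ A : X × Y → X →L[ℝ] Y, ContDiffOn ℝ ∞ A e.target ∧
      ∀ q ∈ e.source, ∀ v : TangentSpace 𝓘(ℝ, E) q, v ∈ horizontal (E' := E') F q ↔
        (mvfderiv 𝓘(ℝ, E) e q v).2 = A (e q) (mvfderiv 𝓘(ℝ, E) e q v).1 := by
  obtain ⟨A, hA, hAg⟩ := exists_graph_of_orthogonal e.open_target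
    he.toIsSmoothChart.contDiffOn_coordMetric
    fun z hz w hw ↦ he.toIsSmoothChart.coordMetric_self_pos hz hw
  refine ⟨A, hA, fun q hq v ↦ ?_⟩
  rw [← hAg (e q) (e.map_source hq), horizontal, Submodule.mem_orthogonal']
  refine ⟨fun h b ↦ ?_, fun h w hw ↦ ?_⟩
  · have hd := he.toIsSmoothChart.mvfderiv_coordField hq fun _ ↦ ((0, b) : X × Y)
    have hv := h (coordField e (fun _ ↦ ((0, b) : X × Y)) q)
      ((he.mem_vertical_iff q hq _).2 (congrArg Prod.fst hd))
    rw [← he.toIsSmoothChart.coordMetric_mvfderiv hq] at hv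
    rwa [hd] at hv
  · have hw₁ : mvfderiv 𝓘(ℝ, E) e q w = (0, (mvfderiv 𝓘(ℝ, E) e q w).2) :=
      Prod.ext ((he.mem_vertical_iff q hq w).1 hw) rfl
    rw [← he.toIsSmoothChart.coordMetric_mvfderiv hq, hw₁]
    exact h _

/-- The connection form of an involutive horizontal distribution is flat. -/
lemma IsAdaptedChart.flat_of_involutive [T2Space M] (he : IsAdaptedChart (E := E) E' F U g e)
    [CompleteSpace X] [CompleteSpace Y]
    (hinv : ∀ Z₁ Z₂ W : VecField E M, IsSmoothSectionOf (horizontal (E' := E') F) Z₁ →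
      IsSmoothSectionOf (horizontal (E' := E') F) Z₂ →
      IsSmoothSectionOf (vertical (E' := E') F) W →
      ∀ x, inner ℝ (bracket Z₁ Z₂ x) (W x) = (0 : ℝ))
    {A : X × Y → X →L[ℝ] Y} (hA : ContDiffOn ℝ ∞ A e.target)
    (hAh : ∀ q ∈ e.source, ∀ v : TangentSpace 𝓘(ℝ, E) q, v ∈ horizontal (E' := E') F q ↔
        (mvfderiv 𝓘(ℝ, E) e q v).2 = A (e q) (mvfderiv 𝓘(ℝ, E) e q v).1)
    {z : X × Y} (hz : z ∈ e.target) (a b : X) :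
    fderiv ℝ A z (a, A z a) b = fderiv ℝ A z (b, A z b) a := by
  obtain ⟨q, hq, rfl⟩ : ∃ q ∈ e.source, e q = z := ⟨e.symm z, e.map_target hz, e.right_inv hz⟩
  have hs := he.toIsSmoothChart
  have hsrc : ∀ᶠ y in 𝓝 q, y ∈ e.source := e.open_source.mem_nhds hq
  have hAd : DifferentiableAt ℝ A (e q) :=
    (hA.contDiffAt (e.open_target.mem_nhds hz)).differentiableAt (by simp)
  have hor : ∀ c : X, ∃ Z : VecField E M, IsSmoothSectionOf (horizontal (E' := E') F) Z ∧
      ∀ᶠ y in 𝓝 q, mvfderiv 𝓘(ℝ, E) e y (Z y) = (c, A (e y) c) := by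
    intro c
    obtain ⟨Z, hZ, hZe⟩ := exists_isSmoothSectionOf_eventuallyEq
      (D := horizontal (E := E) (E' := E') F) e.open_source
      (hs.contMDiffOn_coordField (W := fun z ↦ (c, A z c))
        (contDiffOn_const.prodMk (hA.clm_apply contDiffOn_const)))
      (fun y hy ↦ (hAh y hy _).2 (by rw [hs.mvfderiv_coordField hy])) hq
    refine ⟨Z, hZ, ?_⟩
    filter_upwards [hZe, hsrc] with y hy hys
    rw [hy, hs.mvfderiv_coordField hys]
  obtain ⟨Za, hZa, hZa'⟩ := hor a
  obtain ⟨Zb, hZb, hZb'⟩ := hor b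
  have hd : ∀ (c : X) (v : TangentSpace 𝓘(ℝ, E) q),
      mvfderiv 𝓘(ℝ, E) (fun y ↦ ((c, A (e y) c) : X × Y)) q v =
        (0, fderiv ℝ A (e q) (mvfderiv 𝓘(ℝ, E) e q v) c) := by
    intro c v
    have h : HasFDerivAt (fun z : X × Y ↦ (c, A z c)) _ (e q) :=
      (hasFDerivAt_const c _).prodMk (hAd.hasFDerivAt.clm_apply (hasFDerivAt_const c _))
    rw [mvfderiv_fun_comp h.differentiableAt (hs.mdifferentiableAt hq), h.fderiv]
    simp
  have hbr : mvfderiv 𝓘(ℝ, E) e q (bracket Za Zb q) =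
      (0, fderiv ℝ A (e q) (a, A (e q) a) b - fderiv ℝ A (e q) (b, A (e q) b) a) := by
    rw [mvfderiv_bracket (hs.contMDiffAt hq) (hZa.1.mdifferentiableAt q)
      (hZb.1.mdifferentiableAt q), mvfderiv_congr hZb', mvfderiv_congr hZa', hd, hd,
      hZa'.self_of_nhds, hZb'.self_of_nhds]
    simp
  have hbh : bracket Za Zb q ∈ horizontal (E' := E') F q := by
    refine (Submodule.mem_orthogonal' _ _).2 fun w hw ↦ ?_
    obtain ⟨W, hW, hWe⟩ := exists_isSmoothSectionOf_eventuallyEq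
      (D := vertical (E := E) (E' := E') F) e.open_source
      (hs.contMDiffOn_coordField (W := fun _ ↦ mvfderiv 𝓘(ℝ, E) e q w) contDiffOn_const)
      (fun y hy ↦ (he.mem_vertical_iff y hy _).2 (by
        rw [hs.mvfderiv_coordField hy]
        exact (he.mem_vertical_iff q hq w).1 hw)) hq
    have h := hinv Za Zb W hZa hZb hW q
    rwa [hWe.self_of_nhds, hs.coordField_mvfderiv hq] at h
  have h := (hAh q hq _).1 hbh
  rw [hbr, map_zero] at h
  exact sub_eq_zero.1 h

end Flatness

section Straightening

universe u

variable {E : Type*} [NormedAddCommGroup E] [NormedSpace ℝ E] [FiniteDimensional ℝ E]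
  {M : Type*} [TopologicalSpace M] [ChartedSpace E M]
  [Bundle.RiemannianBundle (fun x : M ↦ TangentSpace 𝓘(ℝ, E) x)]
  {E' : Type*} [NormedAddCommGroup E'] [NormedSpace ℝ E']
  {N : Type*} [TopologicalSpace N] [ChartedSpace E' N] {F : M → N}
  {X Y : Type u} [NormedAddCommGroup X] [NormedSpace ℝ X] [NormedAddCommGroup Y] [NormedSpace ℝ Y]
  {U : Set X} {g : X → X →L[ℝ] X →L[ℝ] ℝ} {e : OpenPartialHomeomorph M (X × Y)}

/-- The isomorphism that takes the graph of `A` to the second and `Y` to the first factor. -/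
def shearSwap (A : X →L[ℝ] Y) : (X × Y) ≃L[ℝ] Y × X :=
  .equivOfInverse ((.snd ℝ X Y - A ∘L .fst ℝ X Y).prod (.fst ℝ X Y))
    ((ContinuousLinearMap.snd ℝ Y X).prod (.fst ℝ Y X + A ∘L .snd ℝ Y X))
    (fun w ↦ by simp) (fun w ↦ by simp)

/-- If the connection form is flat, replacing the second component of an adapted chart by first
integrals of the horizontal distribution makes both distributions tangent to the factors. -/
lemma IsAdaptedChart.exists_productChart [FiniteDimensional ℝ X] [FiniteDimensional ℝ Y]
    (he : IsAdaptedChart (E := E) E' F U g e) {A : X × Y → X →L[ℝ] Y}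
    (hA : ContDiffOn ℝ ∞ A e.target)
    (hAh : ∀ q ∈ e.source, ∀ v : TangentSpace 𝓘(ℝ, E) q, v ∈ horizontal (E' := E') F q ↔
        (mvfderiv 𝓘(ℝ, E) e q v).2 = A (e q) (mvfderiv 𝓘(ℝ, E) e q v).1)
    (hflat : ∀ z ∈ e.target, ∀ a b, fderiv ℝ A z (a, A z a) b = fderiv ℝ A z (b, A z b) a)
    {p : M} (hp : p ∈ e.source) :
    ∃ (e' : OpenPartialHomeomorph M (Y × X)) (r : ℝ), IsSmoothChart (E := E) e' ∧ 0 < r ∧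
      p ∈ e'.source ∧ e'.target = Metric.ball (e' p).1 r ×ˢ Metric.ball (e' p).2 r ∧
      ∀ q ∈ e'.source, ((e' q).2 ∈ U ∧ ∀ v : TangentSpace 𝓘(ℝ, E) q,
        (v ∈ vertical (E' := E') F q ↔ (mvfderiv 𝓘(ℝ, E) e' q v).2 = 0) ∧
        (v ∈ horizontal (E' := E') F q ↔ (mvfderiv 𝓘(ℝ, E) e' q v).1 = 0)) ∧
        ∀ v ∈ horizontal (E := E) (E' := E') F q, ∀ w ∈ horizontal (E := E) (E' := E') F q,
          inner ℝ v w =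
            g (e' q).2 (mvfderiv 𝓘(ℝ, E) e' q v).2 (mvfderiv 𝓘(ℝ, E) e' q w).2 := by
  have hs := he.toIsSmoothChart
  obtain ⟨O, G, hO, hpO, hOe, hG, hGA, hG₀⟩ :=
    exists_firstIntegral e.open_target hA hflat (e.map_source hp)
  have hGd : ∀ z ∈ O, DifferentiableAt ℝ G z := fun z hz ↦
    (hG.contDiffAt (hO.mem_nhds hz)).differentiableAt (by simp)
  have hT : HasFDerivAt (fun z ↦ (G z, z.1)) (shearSwap (A (e p)) : X × Y →L[ℝ] Y × X) (e p) := by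
    have h : (shearSwap (A (e p)) : X × Y →L[ℝ] Y × X) =
        (fderiv ℝ G (e p)).prod (.fst ℝ X Y) := by
      refine ContinuousLinearMap.ext fun w ↦ Prod.ext ?_ rfl
      change w.2 - A (e p) w.1 = fderiv ℝ G (e p) w
      have hw : w = (w.1, A (e p) w.1) + (0, w.2 - A (e p) w.1) := by simp
      conv_rhs => rw [hw, map_add, hGA _ hpO, hG₀, zero_add]
    rw [h]
    exact (hGd _ hpO).hasFDerivAt.prodMk hasFDerivAt_fst
  have hΘ : ContDiffOn ℝ ∞ (fun z : X × Y ↦ (G z, z.1)) O := hG.prodMk contDiff_fst.contDiffOn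
  obtain ⟨Θ, hΘe, hpΘ, hΘO, hΘs⟩ :=
    exists_openPartialHomeomorph_of_contDiffOn hO hΘ hpO (shearSwap (A (e p))) hT
  have hsΘ : IsSmoothChart (E := E) (e.trans Θ) :=
    hs.trans ((hΘ.mono hΘO).congr fun z _ ↦ hΘe z) hΘs
  have hpt : p ∈ (e.trans Θ).source := by simpa [hp] using hpΘ
  obtain ⟨r, hr, hball⟩ := Metric.isOpen_iff.1 (e.trans Θ).open_target _
    ((e.trans Θ).map_source hpt)
  obtain ⟨e', hs', ht', hee, hsource, hmem⟩ := hsΘ.exists_target_eq Metric.isOpen_ball hball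
  have hval : ∀ q, e' q = (G (e q), (e q).1) := fun q ↦ by
    rw [hee q, OpenPartialHomeomorph.coe_trans, Function.comp_apply, hΘe]
  have hsrc : ∀ q ∈ e'.source, q ∈ e.source ∧ e q ∈ O := fun q hq ↦ by
    have h : q ∈ e.source ∧ e q ∈ Θ.source := by simpa using hsource hq
    exact ⟨h.1, hΘO h.2⟩
  have hd : ∀ q ∈ e'.source, ∀ v : TangentSpace 𝓘(ℝ, E) q, mvfderiv 𝓘(ℝ, E) e' q v =
      (fderiv ℝ G (e q) (mvfderiv 𝓘(ℝ, E) e q v), (mvfderiv 𝓘(ℝ, E) e q v).1) := by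
    intro q hq v
    have h : HasFDerivAt (fun z : X × Y ↦ (G z, z.1)) _ (e q) :=
      (hGd _ (hsrc q hq).2).hasFDerivAt.prodMk hasFDerivAt_fst
    rw [mvfderiv_congr (.of_forall hval),
      mvfderiv_fun_comp h.differentiableAt (hs.mdifferentiableAt (hsrc q hq).1), h.fderiv]
    rfl
  have hver : ∀ q ∈ e'.source, ∀ v : TangentSpace 𝓘(ℝ, E) q,
      v ∈ vertical (E' := E') F q ↔ (mvfderiv 𝓘(ℝ, E) e' q v).2 = 0 := fun q hq v ↦ by
    rw [hd q hq]
    exact he.mem_vertical_iff q (hsrc q hq).1 v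
  have hhor : ∀ q ∈ e'.source, ∀ v ∈ horizontal (E := E) (E' := E') F q,
      (mvfderiv 𝓘(ℝ, E) e' q v).1 = 0 := fun q hq v hv ↦ by
    rw [hd q hq]
    have h : mvfderiv 𝓘(ℝ, E) e q v = ((mvfderiv 𝓘(ℝ, E) e q v).1,
        A (e q) (mvfderiv 𝓘(ℝ, E) e q v).1) := Prod.ext rfl ((hAh q (hsrc q hq).1 v).1 hv)
    rw [h]
    exact hGA _ (hsrc q hq).2 _
  refine ⟨e', r, hs', hr, hmem p hpt (Metric.mem_ball_self hr), ?_, fun q hq ↦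
    ⟨⟨?_, fun v ↦ ⟨hver q hq v, hhor q hq v, fun h ↦ ?_⟩⟩, fun v hv w hw ↦ ?_⟩⟩
  · rw [ht', hee p, ball_prod_same]
  · rw [hval q]
    exact he.fst_mem q (hsrc q hq).1
  · -- the vertical part of `v` has zero coordinates
    obtain ⟨v₁, hv₁, v₂, hv₂, rfl⟩ := Submodule.mem_sup.1
      ((Submodule.sup_orthogonal_of_hasOrthogonalProjection
        (K := vertical (E := E) (E' := E') F q)).ge (Submodule.mem_top (x := v)))
    have h₁ : (mvfderiv 𝓘(ℝ, E) e' q v₁).1 = 0 := by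
      rw [map_add, Prod.fst_add, hhor q hq v₂ hv₂, add_zero] at h
      exact h
    have h₀ : v₁ = 0 := hs'.mvfderiv_injective hq (by
      rw [map_zero]
      exact Prod.ext h₁ ((hver q hq v₁).1 hv₁))
    rw [h₀, zero_add]
    exact hv₂
  · rw [hd q hq, hd q hq, hval q]
    exact he.inner_eq q (hsrc q hq).1 v hv w hw

end Straightening

/-! ### The metric of the leaves -/

section Splitting

variable {E : Type*} [NormedAddCommGroup E] [NormedSpace ℝ E] [FiniteDimensional ℝ E]
  {M : Type*} [TopologicalSpace M] [ChartedSpace E M] [IsManifold 𝓘(ℝ, E) ∞ M]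

/-- A coordinate field with constant coefficients that is tangent to a distribution extends, near a
given point, to a global section. -/
lemma IsSmoothChart.exists_section_coordField [T2Space M]
    {B : Type*} [NormedAddCommGroup B] [NormedSpace ℝ B]
    {e : OpenPartialHomeomorph M B} (he : IsSmoothChart (E := E) e) {D : TangentDistribution E M}
    {a : B} (hD : ∀ q ∈ e.source, ∀ v : TangentSpace 𝓘(ℝ, E) q,
      mvfderiv 𝓘(ℝ, E) e q v = a → v ∈ D q) {q : M} (hq : q ∈ e.source) :
    ∃ Z : VecField E M, IsSmoothSectionOf D Z ∧
      ∀ᶠ y in 𝓝 q, mvfderiv 𝓘(ℝ, E) e y (Z y) = a := by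
  obtain ⟨Z, hZ, hZe⟩ := exists_isSmoothSectionOf_eventuallyEq (D := D) e.open_source
    (he.contMDiffOn_coordField contDiffOn_const)
    (fun y hy ↦ hD y hy _ (he.mvfderiv_coordField hy fun _ ↦ a)) hq
  refine ⟨Z, hZ, ?_⟩
  filter_upwards [hZe, e.open_source.mem_nhds hq] with y hy hys
  rw [hy, he.mvfderiv_coordField hys]

lemma IsSmoothChart.bracket_eq_zero {B : Type*} [NormedAddCommGroup B] [NormedSpace ℝ B]
    {e : OpenPartialHomeomorph M B} (he : IsSmoothChart (E := E) e) {q : M} (hq : q ∈ e.source)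
    {Z₁ Z₂ : VecField E M} (hZ₁ : IsSmoothVecField Z₁) (hZ₂ : IsSmoothVecField Z₂) {a₁ a₂ : B}
    (h₁ : ∀ᶠ y in 𝓝 q, mvfderiv 𝓘(ℝ, E) e y (Z₁ y) = a₁)
    (h₂ : ∀ᶠ y in 𝓝 q, mvfderiv 𝓘(ℝ, E) e y (Z₂ y) = a₂) : bracket Z₁ Z₂ q = 0 := by
  refine he.mvfderiv_injective hq ?_
  rw [mvfderiv_bracket (he.contMDiffAt hq) (hZ₁.mdifferentiableAt q) (hZ₂.mdifferentiableAt q),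
    mvfderiv_congr (g := fun _ ↦ a₂) h₂, mvfderiv_congr (g := fun _ ↦ a₁) h₁, mvfderiv_const,
    mvfderiv_const]
  simp

variable [Bundle.RiemannianBundle (fun x : M ↦ TangentSpace 𝓘(ℝ, E) x)]
  {E' : Type*} [NormedAddCommGroup E'] [NormedSpace ℝ E']
  {N : Type*} [TopologicalSpace N] [ChartedSpace E' N] {F : M → N}
  {X Y : Type*} [NormedAddCommGroup X] [NormedSpace ℝ X] [FiniteDimensional ℝ X]
  [NormedAddCommGroup Y] [NormedSpace ℝ Y] [FiniteDimensional ℝ Y]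
  {e : OpenPartialHomeomorph M (Y × X)}
  [IsContMDiffRiemannianBundle 𝓘(ℝ, E) ∞ E (fun x : M ↦ TangentSpace 𝓘(ℝ, E) x)]

lemma IsSmoothChart.differentiableAt_coordMetric {B : Type*} [NormedAddCommGroup B]
    [NormedSpace ℝ B] [FiniteDimensional ℝ B] {e : OpenPartialHomeomorph M B}
    (he : IsSmoothChart (E := E) e) {z : B} (hz : z ∈ e.target) (v w : B) :
    DifferentiableAt ℝ (fun z ↦ coordMetric (E := E) e z v w) z := by
  have h := (he.contDiffOn_coordMetric.clm_apply contDiffOn_const).clm_apply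
    (contDiffOn_const (c := w)) (f := fun z ↦ coordMetric (E := E) e z v)
  exact (h.contDiffAt (e.open_target.mem_nhds hz)).differentiableAt (by simp)

/-- If the fibres are totally geodesic, their metric does not vary along the second factor of a
chart in which the vertical and the horizontal distribution are tangent to the factors. -/
lemma IsSmoothChart.fderiv_coordMetric_eq_zero [T2Space M] (he : IsSmoothChart (E := E) e)
    (hver : ∀ q ∈ e.source, ∀ v : TangentSpace 𝓘(ℝ, E) q,
      v ∈ vertical (E' := E') F q ↔ (mvfderiv 𝓘(ℝ, E) e q v).2 = 0)
    (hhor : ∀ q ∈ e.source, ∀ v : TangentSpace 𝓘(ℝ, E) q,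
      v ∈ horizontal (E' := E') F q ↔ (mvfderiv 𝓘(ℝ, E) e q v).1 = 0)
    (hT : ∀ V W Z : VecField E M, IsSmoothSectionOf (vertical (E' := E') F) V →
      IsSmoothSectionOf (vertical (E' := E') F) W →
      IsSmoothSectionOf (horizontal (E' := E') F) Z → ∀ x, koszul V W Z x = 0)
    {z : Y × X} (hz : z ∈ e.target) (a b : Y) (c : X) :
    fderiv ℝ (fun z ↦ coordMetric (E := E) e z (a, 0) (b, 0)) z (0, c) = 0 := by
  obtain ⟨q, hq, rfl⟩ : ∃ q ∈ e.source, e q = z := ⟨e.symm z, e.map_target hz, e.right_inv hz⟩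
  have hD : ∀ a : Y, ∀ q ∈ e.source, ∀ v : TangentSpace 𝓘(ℝ, E) q,
      mvfderiv 𝓘(ℝ, E) e q v = (a, 0) → v ∈ vertical (E' := E') F q := fun a q hq v h ↦
    (hver q hq v).2 (by rw [h])
  obtain ⟨V, hV, hV'⟩ := he.exists_section_coordField (hD a) hq
  obtain ⟨W, hW, hW'⟩ := he.exists_section_coordField (hD b) hq
  obtain ⟨Z, hZ, hZ'⟩ := he.exists_section_coordField (D := horizontal (E := E) (E' := E') F)
    (a := ((0, c) : Y × X)) (fun q hq v h ↦ (hhor q hq v).2 (by rw [h])) hq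
  have hVW : metricFun V W =ᶠ[𝓝 q] fun y ↦ coordMetric (E := E) e (e y) (a, 0) (b, 0) := by
    filter_upwards [hV', hW', e.open_source.mem_nhds hq] with y h1 h2 hy
    rw [← h1, ← h2, he.coordMetric_mvfderiv hy]
    rfl
  have h := hT V W Z hV hW hZ q
  rw [koszul, metricFun_vert_hor hW.2 hZ.2, metricFun_vert_hor hV.2 hZ.2, lieDer_const,
    lieDer_const, he.bracket_eq_zero hq hV.1 hW.1 hV' hW', he.bracket_eq_zero hq hV.1 hZ.1 hV' hZ',
    he.bracket_eq_zero hq hW.1 hZ.1 hW' hZ', lieDer_congr hVW, lieDer,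
    mvfderiv_fun_comp (he.differentiableAt_coordMetric hz _ _)
      (he.mdifferentiableAt hq), hZ'.self_of_nhds] at h
  simpa using h

/-- The integrated form of `IsSmoothChart.fderiv_coordMetric_eq_zero`. -/
lemma IsSmoothChart.coordMetric_eq_of_fst_eq [T2Space M] (he : IsSmoothChart (E := E) e)
    (hver : ∀ q ∈ e.source, ∀ v : TangentSpace 𝓘(ℝ, E) q,
      v ∈ vertical (E' := E') F q ↔ (mvfderiv 𝓘(ℝ, E) e q v).2 = 0)
    (hhor : ∀ q ∈ e.source, ∀ v : TangentSpace 𝓘(ℝ, E) q,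
      v ∈ horizontal (E' := E') F q ↔ (mvfderiv 𝓘(ℝ, E) e q v).1 = 0)
    (hT : ∀ V W Z : VecField E M, IsSmoothSectionOf (vertical (E' := E') F) V →
      IsSmoothSectionOf (vertical (E' := E') F) W →
      IsSmoothSectionOf (horizontal (E' := E') F) Z → ∀ x, koszul V W Z x = 0)
    {y : Y} {S : Set X} (hS : IsOpen S) (hSc : IsPreconnected S)
    (ht : ∀ x ∈ S, (y, x) ∈ e.target) {x x' : X} (hx : x ∈ S) (hx' : x' ∈ S) (a b : Y) :
    coordMetric (E := E) e (y, x) (a, 0) (b, 0) =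
      coordMetric (E := E) e (y, x') (a, 0) (b, 0) := by
  have hder : ∀ x ∈ S, HasFDerivAt
      (fun x ↦ coordMetric (E := E) e (y, x) (a, 0) (b, 0)) (0 : X →L[ℝ] ℝ) x := by
    intro x hx
    have h := (he.differentiableAt_coordMetric (ht x hx) (a, 0) (b, 0)).hasFDerivAt.comp x
      (hasFDerivAt_prodMk_right y x)
    refine h.congr_fderiv (ContinuousLinearMap.ext fun c ↦ ?_)
    exact he.fderiv_coordMetric_eq_zero hver hhor hT (ht x hx) a b c
  exact hS.is_const_of_fderiv_eq_zero hSc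
    (fun x hx ↦ (hder x hx).differentiableAt.differentiableWithinAt)
    (fun x hx ↦ (hder x hx).fderiv) hx hx'

omit [FiniteDimensional ℝ X] in
/-- A metric on an open subset of a product induces a metric on a slice `S × {x₀}`. -/
lemma IsMetricOn.restrict_fst {g : Y × X → Y × X →L[ℝ] Y × X →L[ℝ] ℝ} {Ω : Set (Y × X)}
    (hg : IsMetricOn g Ω) {S : Set Y} (hS : IsOpen S) {x₀ : X} (hx₀ : ∀ y ∈ S, (y, x₀) ∈ Ω) :
    IsMetricOn (fun y ↦ (g (y, x₀)).bilinearComp (.inl ℝ Y X) (.inl ℝ Y X)) S where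
  isOpen := hS
  smooth := by
    have h : ContDiffOn ℝ ∞ (fun y ↦ g (y, x₀)) S :=
      hg.smooth.comp (contDiffOn_id.prodMk contDiffOn_const) hx₀
    exact contDiffOn_clm_apply.2 fun a ↦ contDiffOn_clm_apply.2 fun b ↦
      (h.clm_apply contDiffOn_const).clm_apply contDiffOn_const
  symm y hy a b := hg.symm _ (hx₀ y hy) _ _
  pos y hy a ha := hg.pos _ (hx₀ y hy) _ fun h ↦ ha (congrArg Prod.fst h)

/-- The metric of the leaves, read in the first factor. -/
lemma IsSmoothChart.exists_isMetricOn_fst [T2Space M] (he : IsSmoothChart (E := E) e)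
    (hver : ∀ q ∈ e.source, ∀ v : TangentSpace 𝓘(ℝ, E) q,
      v ∈ vertical (E' := E') F q ↔ (mvfderiv 𝓘(ℝ, E) e q v).2 = 0)
    (hhor : ∀ q ∈ e.source, ∀ v : TangentSpace 𝓘(ℝ, E) q,
      v ∈ horizontal (E' := E') F q ↔ (mvfderiv 𝓘(ℝ, E) e q v).1 = 0)
    (hT : ∀ V W Z : VecField E M, IsSmoothSectionOf (vertical (E' := E') F) V →
      IsSmoothSectionOf (vertical (E' := E') F) W →
      IsSmoothSectionOf (horizontal (E' := E') F) Z → ∀ x, koszul V W Z x = 0)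
    {y₀ : Y} {x₀ : X} {r : ℝ} (hr : 0 < r)
    (ht : e.target = Metric.ball y₀ r ×ˢ Metric.ball x₀ r) :
    ∃ γ : Y → Y →L[ℝ] Y →L[ℝ] ℝ, IsMetricOn γ (Metric.ball y₀ r) ∧
      ∀ q ∈ e.source, ∀ v ∈ vertical (E := E) (E' := E') F q,
        ∀ w ∈ vertical (E := E) (E' := E') F q, inner ℝ v w =
          γ (e q).1 (mvfderiv 𝓘(ℝ, E) e q v).1 (mvfderiv 𝓘(ℝ, E) e q w).1 := by
  have hmem : ∀ {y : Y} {x : X}, y ∈ Metric.ball y₀ r → x ∈ Metric.ball x₀ r →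
      (y, x) ∈ e.target := by
    intro y x hy hx
    rw [ht]
    exact ⟨hy, hx⟩
  have hx₀ : x₀ ∈ Metric.ball x₀ r := Metric.mem_ball_self hr
  refine ⟨_, he.isMetricOn_coordMetric.restrict_fst Metric.isOpen_ball fun y hy ↦ hmem hy hx₀,
    fun q hq v hv w hw ↦ ?_⟩
  have hq' : (e q).1 ∈ Metric.ball y₀ r ∧ (e q).2 ∈ Metric.ball x₀ r := by
    have h := e.map_source hq
    rwa [ht, mem_prod] at h
  have hv' : mvfderiv 𝓘(ℝ, E) e q v = ((mvfderiv 𝓘(ℝ, E) e q v).1, 0) :=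
    Prod.ext rfl ((hver q hq v).1 hv)
  have hw' : mvfderiv 𝓘(ℝ, E) e q w = ((mvfderiv 𝓘(ℝ, E) e q w).1, 0) :=
    Prod.ext rfl ((hver q hq w).1 hw)
  rw [← he.coordMetric_mvfderiv hq, hv', hw']
  exact he.coordMetric_eq_of_fst_eq hver hhor hT Metric.isOpen_ball
    (convex_ball x₀ r).isPreconnected (fun x hx ↦ hmem hq'.1 hx) hq'.2 hx₀ _ _

omit [FiniteDimensional ℝ X] [FiniteDimensional ℝ Y] [IsManifold 𝓘(ℝ, E) ∞ M]
  [IsContMDiffRiemannianBundle 𝓘(ℝ, E) ∞ E (fun x : M ↦ TangentSpace 𝓘(ℝ, E) x)] in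
/-- As the vertical and the horizontal distribution are orthogonal, a metric that is given by `γ`
on the first and by `g` on the second is a product metric. -/
lemma inner_eq_add_of_vertical_horizontal {q : M} {γ : Y →L[ℝ] Y →L[ℝ] ℝ} {g : X →L[ℝ] X →L[ℝ] ℝ}
    {d : TangentSpace 𝓘(ℝ, E) q →L[ℝ] Y × X}
    (hver : ∀ v ∈ vertical (E := E) (E' := E') F q, (d v).2 = 0)
    (hhor : ∀ v ∈ horizontal (E := E) (E' := E') F q, (d v).1 = 0)
    (hγ : ∀ v ∈ vertical (E := E) (E' := E') F q, ∀ w ∈ vertical (E := E) (E' := E') F q,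
      inner ℝ v w = γ (d v).1 (d w).1)
    (hg : ∀ v ∈ horizontal (E := E) (E' := E') F q, ∀ w ∈ horizontal (E := E) (E' := E') F q,
      inner ℝ v w = g (d v).2 (d w).2) (v w : TangentSpace 𝓘(ℝ, E) q) :
    inner ℝ v w = γ (d v).1 (d w).1 + g (d v).2 (d w).2 := by
  have hdec : ∀ v : TangentSpace 𝓘(ℝ, E) q, ∃ v₁ ∈ vertical (E := E) (E' := E') F q,
      ∃ v₂ ∈ horizontal (E := E) (E' := E') F q, v₁ + v₂ = v := fun v ↦
    Submodule.mem_sup.1 ((Submodule.sup_orthogonal_of_hasOrthogonalProjection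
      (K := vertical (E := E) (E' := E') F q)).ge Submodule.mem_top)
  obtain ⟨v₁, hv₁, v₂, hv₂, rfl⟩ := hdec v
  obtain ⟨w₁, hw₁, w₂, hw₂, rfl⟩ := hdec w
  rw [inner_add_left, inner_add_right, inner_add_right, inner_eq_zero_of_vertical hv₁ hw₂,
    inner_eq_zero_of_horizontal hv₂ hw₁, hγ v₁ hv₁ w₁ hw₁, hg v₂ hv₂ w₂ hw₂, map_add, map_add,
    Prod.fst_add, Prod.fst_add, Prod.snd_add, Prod.snd_add, hver v₁ hv₁, hver w₁ hw₁,
    hhor v₂ hv₂, hhor w₂ hw₂]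
  simp

end Splitting

/-! ### The local product structure -/

section Equivalence

variable {E : Type*} [NormedAddCommGroup E] [NormedSpace ℝ E] [FiniteDimensional ℝ E]
  {M : Type*} [TopologicalSpace M] [T2Space M] [ChartedSpace E M] [IsManifold 𝓘(ℝ, E) ∞ M]
  [Bundle.RiemannianBundle (fun x : M ↦ TangentSpace 𝓘(ℝ, E) x)]
  [IsContMDiffRiemannianBundle 𝓘(ℝ, E) ∞ E (fun x : M ↦ TangentSpace 𝓘(ℝ, E) x)]
  {E' : Type*} [NormedAddCommGroup E'] [NormedSpace ℝ E'] [FiniteDimensional ℝ E']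
  {N : Type*} [TopologicalSpace N] [ChartedSpace E' N] [IsManifold 𝓘(ℝ, E') ∞ N]
  [Bundle.RiemannianBundle (fun y : N ↦ TangentSpace 𝓘(ℝ, E') y)]
  [IsContMDiffRiemannianBundle 𝓘(ℝ, E') ∞ E' (fun y : N ↦ TangentSpace 𝓘(ℝ, E') y)]
  {F : M → N}

/-- The total space of a Riemannian submersion with involutive horizontal distribution and totally
geodesic fibres is locally a Riemannian product. -/
lemma IsRiemannianSubmersion.isLocallyProduct
    (hF : IsRiemannianSubmersion (E := E) (E' := E') F)
    (hA : ∀ Z₁ Z₂ W : VecField E M, IsSmoothSectionOf (horizontal (E' := E') F) Z₁ →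
      IsSmoothSectionOf (horizontal (E' := E') F) Z₂ →
      IsSmoothSectionOf (vertical (E' := E') F) W →
      ∀ x, inner ℝ (bracket Z₁ Z₂ x) (W x) = (0 : ℝ))
    (hT : ∀ V W Z : VecField E M, IsSmoothSectionOf (vertical (E' := E') F) V →
      IsSmoothSectionOf (vertical (E' := E') F) W →
      IsSmoothSectionOf (horizontal (E' := E') F) Z → ∀ x, koszul V W Z x = 0) :
    IsLocallyProduct (vertical (E := E) (E' := E') F) (horizontal (E := E) (E' := E') F) := by
  intro p
  have hle := hF.finrank_le p
  obtain ⟨U, g, e₀, hg, he₀, hp₀⟩ := hF.exists_isAdaptedChart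
    (X := EuclideanSpace ℝ (Fin (Module.finrank ℝ E')))
    (Y := EuclideanSpace ℝ (Fin (Module.finrank ℝ E - Module.finrank ℝ E'))) (by simp)
    (by simp only [finrank_euclideanSpace_fin]; omega) p
  obtain ⟨A, hAs, hAh⟩ := he₀.exists_connectionForm
  obtain ⟨e, r, he, hr, hp, ht, hprod⟩ := he₀.exists_productChart hAs hAh
    (fun z hz a b ↦ he₀.flat_of_involutive hA hAs hAh hz a b) hp₀
  have hver := fun q hq v ↦ ((hprod q hq).1.2 v).1
  have hhor := fun q hq v ↦ ((hprod q hq).1.2 v).2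
  obtain ⟨γ, hγ, hγi⟩ := he.exists_isMetricOn_fst hver hhor hT hr ht
  have hball : Metric.ball (e p).2 r ⊆ U := fun x hx ↦ by
    have hz : ((e p).1, x) ∈ e.target := by
      rw [ht]
      exact ⟨Metric.mem_ball_self hr, hx⟩
    have h := (hprod _ (e.map_target hz)).1.1
    rwa [e.right_inv hz] at h
  exact ⟨_, _, Metric.ball (e p).1 r, Metric.ball (e p).2 r, γ, g, e, hγ,
    ⟨Metric.isOpen_ball, hg.smooth.mono hball, fun u hu ↦ hg.symm u (hball hu),
      fun u hu ↦ hg.pos u (hball hu)⟩, hp, ht, he.smooth, he.smooth_symm, fun q hq ↦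
    ⟨hver q hq, hhor q hq, inner_eq_add_of_vertical_horizontal (fun v hv ↦ (hver q hq v).1 hv)
      (fun v hv ↦ (hhor q hq v).1 hv) (hγi q hq) (hprod q hq).2⟩⟩

end Equivalence

end

theorem theorem18 (m : ℕ)
    {E : Type*} [NormedAddCommGroup E] [NormedSpace ℝ E] [FiniteDimensional ℝ E]
    (hdim : Module.finrank ℝ E = 2 * m + 1)
    {M : Type*} [TopologicalSpace M] [T2Space M] [ChartedSpace E M] [IsManifold 𝓘(ℝ, E) ∞ M]
    [Bundle.RiemannianBundle (fun x : M ↦ TangentSpace 𝓘(ℝ, E) x)]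
    [IsContMDiffRiemannianBundle 𝓘(ℝ, E) ∞ E (fun x : M ↦ TangentSpace 𝓘(ℝ, E) x)]
    {E' : Type*} [NormedAddCommGroup E'] [NormedSpace ℝ E'] [FiniteDimensional ℝ E']
    {N : Type*} [TopologicalSpace N] [T2Space N] [ChartedSpace E' N] [IsManifold 𝓘(ℝ, E') ∞ N]
    [Bundle.RiemannianBundle (fun y : N ↦ TangentSpace 𝓘(ℝ, E') y)]
    [IsContMDiffRiemannianBundle 𝓘(ℝ, E') ∞ E' (fun y : N ↦ TangentSpace 𝓘(ℝ, E') y)]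
    (φ : EndoField E M) (ξ : VecField E M) (η : OneForm E M) (hM : IsCosymplectic φ ξ η)
    (F : M → N) (hF : IsRiemannianSubmersion (E := E) (E' := E') F)
    (hanti : IsAntiInvariant (E' := E') φ F)
    (hsplit : ∀ x : M,
      Disjoint ((vertical (E' := E') F x).map (φ x).toLinearMap) (Submodule.span ℝ {ξ x}) ∧
      horizontal (E' := E') F x =
        (vertical (E' := E') F x).map (φ x).toLinearMap ⊔ Submodule.span ℝ {ξ x}) :
    IsLocallyProduct (vertical (E := E) (E' := E') F) (horizontal (E := E) (E' := E') F) ↔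
      (∀ X Y : VecField E M,
        IsSmoothSectionOf (horizontal (E' := E') F) X →
        IsSmoothSectionOf (horizontal (E' := E') F) Y →
        ∀ x : M, oneillA E' F X (φ.app Y) x = 0) ∧
      (∀ V W : VecField E M,
        IsSmoothSectionOf (vertical (E' := E') F) V →
        IsSmoothSectionOf (vertical (E' := E') F) W →
        ∀ x : M, oneillT E' F V (φ.app W) x = 0) := by
  have hφ : ExchangesFibres E' φ ξ F := hM.exchangesFibres hanti fun x ↦ (hsplit x).2
  refine ⟨fun h ↦ ⟨fun X Y hX hY x ↦ ?_, fun V W hV hW x ↦ ?_⟩, fun h ↦ ?_⟩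
  · have hφY : IsSmoothSectionOf (vertical (E := E) (E' := E') F) (φ.app Y) :=
      ⟨hM.smooth_phi.app hY.1, fun y ↦ hφ.map_horizontal y _ (hY.2 y)⟩
    exact (oneillA_eq_zero_iff hX.2 hφY.2 x).2 (h.inner_leviCivita_eq_zero hX hφY x).1
  · have hφW : IsSmoothSectionOf (horizontal (E := E) (E' := E') F) (φ.app W) :=
      ⟨hM.smooth_phi.app hW.1, fun y ↦ hφ.map_vertical y _ (hW.2 y)⟩
    exact (oneillT_eq_zero_iff hV.2 hφW.2 x).2 (h.inner_leviCivita_eq_zero hφW hV x).2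
  · exact hF.isLocallyProduct
      (fun _ _ _ h₁ h₂ hW ↦ hM.inner_bracket_eq_zero hφ h.1 h₁ h₂ hW)
      fun _ _ _ hV hW hZ ↦ hM.koszul_eq_zero hφ h.2 hV hZ hW
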